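/- All graphs are finite and simple, with at least one vertex. For graphs $G$ and $H$ with disjoint vertex sets, the $0$-sum of $G$ and $H$ is their disjoint union, a $1$-sum is obtained from the disjoint union by identifying a vertex of $G$ with a vertex of $H$, and the join is obtained from the disjoint union by adding all edges between vertices of $G$ and vertices of $H$. A graph is a *sesquicograph* if it can be generated, up to isomorphism, from the one-vertex graph $K_1$ by joins, $0$-sums and $1$-sums. An *induced minor* of $G$ is a graph obtained from $G$ by a finite (possibly empty) sequence of operations, each a vertex deletion or an edge contraction, where after a contraction all but one edge of each parallel class is deleted, so that the graph stays simple. Let $C_5$ be the cycle with five vertices and $\overline{P_5}$ the complement of the path with five vertices. Let $H_1,\dots,H_5$ be the graphs obtained from the $6$-cycle $0\,1\,2\,3\,4\,5\,0$ by adding the following chords: - $H_1$: $14,\ 24,\ 25,\ 15$; - $H_2$: $14,\ 24,\ 25$; - $H_3$: $14,\ 25$; - $H_4$: $15,\ 14,\ 24$; - $H_5$: $13,\ 35,\ 15$. **Theorem.** A graph $G$ is a sesquicograph if and only if $G$ has no induced minor isomorphic to a graph in $\{C_5, \overline{P_5}, H_1, H_2, H_3, H_4, H_5\}$. -/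

import Mathlib

namespace Sesqui

universe u v w

/-- The join of two disjoint graphs: their disjoint union together with all edges between
a vertex of `G` and a vertex of `H`. -/
def join {V : Type u} {W : Type v} (G : SimpleGraph V) (H : SimpleGraph W) :
    SimpleGraph (V ⊕ W) :=
  SimpleGraph.sum G H ⊔ completeBipartiteGraph V W

/-- The `1`-sum of `G` and `H` obtained by identifying the vertex `a` of `G` with the vertex `b`
of `H`. The vertices are those of `G`, together with those of `H` other than `b`; the identified
vertex is `Sum.inl a`. -/
def oneSum {V : Type u} {W : Type v} (G : SimpleGraph V) (a : V) (H : SimpleGraph W) (b : W) :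
    SimpleGraph (V ⊕ {y : W // y ≠ b}) where
  Adj
    | Sum.inl x, Sum.inl y => G.Adj x y
    | Sum.inr x, Sum.inr y => H.Adj x y
    | Sum.inl x, Sum.inr y => x = a ∧ H.Adj b y
    | Sum.inr x, Sum.inl y => y = a ∧ H.Adj b x
  symm.symm
    | Sum.inl _, Sum.inl _, h => G.adj_symm h
    | Sum.inr _, Sum.inr _, h => H.adj_symm h
    | Sum.inl _, Sum.inr _, h => h
    | Sum.inr _, Sum.inl _, h => h
  loopless.irrefl
    | Sum.inl x, h => G.irrefl (v := x) h
    | Sum.inr x, h => H.irrefl (v := (x : W)) h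

/-- A sesquicograph is a graph that can be generated, up to isomorphism, from the one-vertex
graph by joins, `0`-sums (disjoint unions) and `1`-sums. -/
inductive IsSesquicograph : {V : Type u} → SimpleGraph V → Prop
  | single : IsSesquicograph (⊥ : SimpleGraph PUnit.{u + 1})
  | zeroSum {V W : Type u} {G : SimpleGraph V} {H : SimpleGraph W} :
      IsSesquicograph G → IsSesquicograph H → IsSesquicograph (SimpleGraph.sum G H)
  | oneSum {V W : Type u} {G : SimpleGraph V} {H : SimpleGraph W} (a : V) (b : W) :
      IsSesquicograph G → IsSesquicograph H → IsSesquicograph (oneSum G a H b)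
  | join {V W : Type u} {G : SimpleGraph V} {H : SimpleGraph W} :
      IsSesquicograph G → IsSesquicograph H → IsSesquicograph (join G H)
  | iso {V W : Type u} {G : SimpleGraph V} {H : SimpleGraph W} (e : G ≃g H) :
      IsSesquicograph G → IsSesquicograph H

/-- The graph `G - v` obtained by deleting the vertex `v`. -/
def deleteVertex {V : Type u} (G : SimpleGraph V) (v : V) : SimpleGraph {x : V // x ≠ v} :=
  G.comap Subtype.val

/-- The simple graph obtained by contracting the edge `uv`: the vertex `v` is removed and `u`,
which plays the role of the contracted edge, becomes adjacent to all other former neighbours of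
`v`. (`SimpleGraph.fromRel` symmetrizes the relation and discards loops.) It is only
used when `u` and `v` are adjacent. -/
def contractEdge {V : Type u} (G : SimpleGraph V) (u v : V) : SimpleGraph {x : V // x ≠ v} :=
  SimpleGraph.fromRel fun x y => G.Adj x y ∨ ((x : V) = u ∧ G.Adj v y)

/-- `HasInducedMinor G H`: a finite, possibly empty, sequence of vertex deletions and edge
contractions takes `G` to a graph isomorphic to `H`. -/
inductive HasInducedMinor : {V : Type u} → {W : Type w} → SimpleGraph V → SimpleGraph W → Prop
  | iso {V : Type u} {W : Type w} {G : SimpleGraph V} {H : SimpleGraph W} (e : G ≃g H) :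
      HasInducedMinor G H
  | delete {V : Type u} {W : Type w} {G : SimpleGraph V} {H : SimpleGraph W} (v : V) :
      HasInducedMinor (deleteVertex G v) H → HasInducedMinor G H
  | contract {V : Type u} {W : Type w} {G : SimpleGraph V} {H : SimpleGraph W} (u v : V)
      (huv : G.Adj u v) : HasInducedMinor (contractEdge G u v) H → HasInducedMinor G H

/-- The cycle of length five. -/
def C5 : SimpleGraph (Fin 5) := SimpleGraph.cycleGraph 5

/-- The complement of the path on five vertices. -/
def P5c : SimpleGraph (Fin 5) := (SimpleGraph.pathGraph 5)ᶜ

/-- A six-cycle `0 1 2 3 4 5` with chords `14`, `42`, `25`, `51`. -/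
def H1 : SimpleGraph (Fin 6) :=
  SimpleGraph.cycleGraph 6 ⊔ SimpleGraph.fromEdgeSet {s(1, 4), s(4, 2), s(2, 5), s(5, 1)}

/-- A six-cycle `0 1 2 3 4 5` with chords `14`, `42`, `25`. -/
def H2 : SimpleGraph (Fin 6) :=
  SimpleGraph.cycleGraph 6 ⊔ SimpleGraph.fromEdgeSet {s(1, 4), s(4, 2), s(2, 5)}

/-- A six-cycle `0 1 2 3 4 5` with chords `14`, `25`. -/
def H3 : SimpleGraph (Fin 6) :=
  SimpleGraph.cycleGraph 6 ⊔ SimpleGraph.fromEdgeSet {s(1, 4), s(2, 5)}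

/-- A six-cycle `0 1 2 3 4 5` with chords `51`, `14`, `42`. -/
def H4 : SimpleGraph (Fin 6) :=
  SimpleGraph.cycleGraph 6 ⊔ SimpleGraph.fromEdgeSet {s(5, 1), s(1, 4), s(4, 2)}

/-- A six-cycle `0 1 2 3 4 5` with chords `15`, `53`, `31`. -/
def H5 : SimpleGraph (Fin 6) :=
  SimpleGraph.cycleGraph 6 ⊔ SimpleGraph.fromEdgeSet {s(1, 5), s(5, 3), s(3, 1)}

end Sesqui

/-!
Call a set `S` of vertices *unsplit* (`IsUnsplit`) if it has at least two elements and the graph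
induced on `S` is neither a join nor disconnected and has no cut vertex. All three requirements are
phrased through bipartitions of a set that must be crossed by a given relation (`IsLinked`).

A sesquicograph has no unsplit set, by induction on its construction, and a finite graph without
unsplit sets is a sesquicograph, since every induced subgraph with at least two vertices decomposes
(`isSesquicograph_iff`). Having no unsplit set is inherited by induced minors
(`HasInducedMinor.exists_isUnsplit`): if `S` is unsplit after the contraction of `uv`, then one of
`S`, `S ∪ {v}` and `S \ {u} ∪ {v}` is unsplit before it. The vertex sets of the seven graphs are
unsplit, so they are not induced minors of sesquicographs.

Conversely, an unsplit set yields one of the seven graphs (`hasForbiddenMinor_of_isUnsplit`), by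
induction on the number of vertices. One may assume that `G` itself is unsplit, but no proper
induced subgraph or contraction is.

* If some `G - v` is a join, one of the seven graphs is already an induced subgraph of `G`
  (`hasForbiddenMinor_of_join`). The main case is that all neighbours of `v` lie on one side `A` of
  the join. Unless such a subgraph appears earlier, a non-neighbour of `v` in `A` with the most
  non-neighbours in `N(v)` has no neighbour in `N(v)` at all; if the other side has two vertices,
  they complete the subgraph, and otherwise an edge leaving the set of all such vertices does.
* Otherwise every `G - v` has a cut vertex, that is, every vertex lies in a 2-vertex cut. By an
  uncrossing argument, a smallest part cut off by two vertices is a single vertex `v`, of degree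
  two (`IsUnsplit.exists_fragment_singleton`). Contracting an edge at `v` can only destroy
  the property of being unsplit by making the graph a join. Then `G - v` plus the edge between the
  two neighbours of `v` is a join while `G - v` is not, and `C₅` or the complement of `P₅` is
  found directly (`hasForbiddenMinor_of_degree_two`).
-/

namespace Sesqui

universe u v w

open Set

/-! ### Linked and unsplit sets -/

/-- `S` is linked by `r` if every partition of `S` into two nonempty parts `X` and `S \ X` is crossed
by a related pair. For a symmetric relation such as `G.Adj` this says that the graph of `r` on `S` is
connected (or empty). -/
def IsLinked {V : Type u} (r : V → V → Prop) (S : Set V) : Prop :=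
  ∀ X ⊆ S, X.Nonempty → (S \ X).Nonempty → ∃ x ∈ X, ∃ y ∈ S \ X, r x y

/-- `S` is unsplit if it has at least two elements and the graph induced on `S` admits none of the
decompositions that generate sesquicographs: it is not a join (`coLinked`), and it is connected
without cut vertices (`linked`; `T = ∅` gives connectedness, a singleton `T` excludes a cut
vertex). -/
structure IsUnsplit {V : Type u} (G : SimpleGraph V) (S : Set V) : Prop where
  nontrivial : S.Nontrivial
  coLinked : IsLinked (fun x y => ¬ G.Adj x y) S
  linked : ∀ T : Set V, T.Subsingleton → IsLinked G.Adj (S \ T)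

theorem IsLinked.image {V : Type u} {W : Type v} {r : V → V → Prop} {s : W → W → Prop}
    {S : Set V} {f : V → W} (hS : IsLinked r S)
    (h : ∀ x ∈ S, ∀ y ∈ S, r x y → s (f x) (f y)) : IsLinked s (f '' S) := by
  rintro X hX ⟨x, hx⟩ ⟨y, hyS, hyX⟩
  obtain ⟨x, hxS, rfl⟩ := hX hx
  obtain ⟨y, hyS, rfl⟩ := hyS
  obtain ⟨p, hp, q, hq, hpq⟩ := hS (S ∩ f ⁻¹' X) inter_subset_left ⟨x, hxS, hx⟩
    ⟨y, hyS, fun h => hyX h.2⟩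
  exact ⟨f p, hp.2, f q, ⟨⟨q, hq.1, rfl⟩, fun h => hq.2 ⟨hq.1, h⟩⟩, h p hp.1 q hq.1 hpq⟩

theorem IsUnsplit.image {V : Type u} {W : Type v} {G : SimpleGraph V} {H : SimpleGraph W}
    {S : Set V} {f : V → W} (hS : IsUnsplit G S) (hf : InjOn f S)
    (h : ∀ x ∈ S, ∀ y ∈ S, H.Adj (f x) (f y) ↔ G.Adj x y) : IsUnsplit H (f '' S) where
  nontrivial := hS.nontrivial.image_of_injOn hf
  coLinked := hS.coLinked.image fun x hx y hy hxy => by rwa [h x hx y hy]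
  linked T hT := by
    have e : f '' S \ T = f '' (S \ (S ∩ f ⁻¹' T)) := by
      ext z
      constructor
      · rintro ⟨⟨x, hx, rfl⟩, hz⟩
        exact ⟨x, ⟨hx, fun h => hz h.2⟩, rfl⟩
      · rintro ⟨x, ⟨hx, hz⟩, rfl⟩
        exact ⟨⟨x, hx, rfl⟩, fun h => hz ⟨hx, h⟩⟩
    rw [e]
    refine (hS.linked _ ?_).image fun x hx y hy hxy => by rwa [h x hx.1 y hy.1]
    exact fun x hx y hy => hf hx.1 hy.1 (hT hx.2 hy.2)

theorem isUnsplit_image_iff {V : Type u} {W : Type v} {G : SimpleGraph V} {H : SimpleGraph W}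
    {S : Set V} {f : V → W} (hf : InjOn f S)
    (h : ∀ x ∈ S, ∀ y ∈ S, H.Adj (f x) (f y) ↔ G.Adj x y) :
    IsUnsplit H (f '' S) ↔ IsUnsplit G S := by
  refine ⟨fun hS => ?_, fun hS => hS.image hf h⟩
  obtain ⟨_, x, _, -⟩ := hS.nontrivial.nonempty
  have : Nonempty V := ⟨x⟩
  have hl : LeftInvOn (Function.invFunOn f S) f S := hf.leftInvOn_invFunOn
  rw [← hl.image_image]
  refine hS.image ?_ ?_
  · rintro _ ⟨x, hx, rfl⟩ _ ⟨y, hy, rfl⟩ hxy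
    rw [hl hx, hl hy] at hxy
    rw [hxy]
  · rintro _ ⟨x, hx, rfl⟩ _ ⟨y, hy, rfl⟩
    rw [hl hx, hl hy, h x hx y hy]

/-! ### Sesquicographs -/

theorem IsUnsplit.of_subset_range {V : Type u} {W : Type v} {G : SimpleGraph V}
    {H : SimpleGraph W} {S : Set W} (hS : IsUnsplit H S) (f : V → W) (hf : Function.Injective f)
    (h : ∀ x y, H.Adj (f x) (f y) ↔ G.Adj x y) (hr : S ⊆ range f) : ∃ S', IsUnsplit G S' := by
  rw [← image_preimage_eq_of_subset hr] at hS
  exact ⟨_, (isUnsplit_image_iff hf.injOn fun x _ y _ => h x y).1 hS⟩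

theorem IsSesquicograph.not_isUnsplit {V : Type u} {G : SimpleGraph V} (hG : IsSesquicograph G) :
    ¬ ∃ S, IsUnsplit G S := by
  induction hG with
  | single =>
    rintro ⟨S, hS⟩
    obtain ⟨x, -, y, -, hxy⟩ := hS.nontrivial
    exact hxy rfl
  | iso e _ ih =>
    rintro ⟨S, hS⟩
    exact ih ⟨_, hS.image (f := e.symm) e.symm.injective.injOn
      fun x _ y _ => e.symm.map_adj_iff⟩
  | @zeroSum V W G H _ _ ihG ihH =>
    rintro ⟨S, hS⟩
    by_cases hr : ∃ y, Sum.inr y ∈ S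
    · by_cases hl : ∃ x, Sum.inl x ∈ S
      · obtain ⟨x, hx⟩ := hl
        obtain ⟨y, hy⟩ := hr
        obtain ⟨p, ⟨hp, p', rfl⟩, q, hq, hpq⟩ := hS.linked ∅ subsingleton_empty (S ∩ range Sum.inl)
          (by simp) ⟨_, hx, x, rfl⟩ ⟨_, ⟨hy, by simp⟩, by simp⟩
        rcases q with q | q
        · exact hq.2 ⟨hq.1.1, q, rfl⟩
        · simp at hpq
      · refine ihH (hS.of_subset_range Sum.inr Sum.inr_injective (by simp) ?_)
        rintro (x | y) hz
        · exact (hl ⟨x, hz⟩).elim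
        · exact ⟨y, rfl⟩
    · refine ihG (hS.of_subset_range Sum.inl Sum.inl_injective (by simp) ?_)
      rintro (x | y) hz
      · exact ⟨x, rfl⟩
      · exact (hr ⟨y, hz⟩).elim
  | @join V W G H _ _ ihG ihH =>
    rintro ⟨S, hS⟩
    by_cases hr : ∃ y, Sum.inr y ∈ S
    · by_cases hl : ∃ x, Sum.inl x ∈ S
      · obtain ⟨x, hx⟩ := hl
        obtain ⟨y, hy⟩ := hr
        obtain ⟨p, ⟨hp, p', rfl⟩, q, hq, hpq⟩ := hS.coLinked (S ∩ range Sum.inl)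
          (by simp) ⟨_, hx, x, rfl⟩ ⟨_, hy, by simp⟩
        rcases q with q | q
        · exact hq.2 ⟨hq.1, q, rfl⟩
        · simp [Sesqui.join] at hpq
      · refine ihH (hS.of_subset_range Sum.inr Sum.inr_injective (by simp [Sesqui.join]) ?_)
        rintro (x | y) hz
        · exact (hl ⟨x, hz⟩).elim
        · exact ⟨y, rfl⟩
    · refine ihG (hS.of_subset_range Sum.inl Sum.inl_injective (by simp [Sesqui.join]) ?_)
      rintro (x | y) hz
      · exact ⟨x, rfl⟩
      · exact (hr ⟨y, hz⟩).elim
  | @oneSum V W G H a b _ _ ihG ihH =>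
    rintro ⟨S, hS⟩
    by_cases hr : ∃ y, Sum.inr y ∈ S
    · by_cases hl : ∃ x, x ≠ a ∧ Sum.inl x ∈ S
      · obtain ⟨x, hxa, hx⟩ := hl
        obtain ⟨y, hy⟩ := hr
        obtain ⟨p, ⟨hp, p', rfl⟩, q, hq, hpq⟩ := hS.linked {Sum.inl a} subsingleton_singleton
          ((S \ {Sum.inl a}) ∩ range Sum.inl)
          inter_subset_left ⟨_, ⟨hx, by simpa using hxa⟩, x, rfl⟩ ⟨_, ⟨hy, by simp⟩, by simp⟩
        rcases q with q | q
        · exact hq.2 ⟨hq.1, q, rfl⟩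
        · exact hp.2 (by simp [hpq.1])
      · classical
        push Not at hl
        refine ihH (hS.of_subset_range
          (fun w => if h : w = b then Sum.inl a else Sum.inr ⟨w, h⟩) ?_ ?_ ?_)
        · intro x y hxy
          dsimp only at hxy
          split_ifs at hxy with h₁ h₂ h₂
          · rw [h₁, h₂]
          · simpa using hxy
        · intro x y
          split_ifs with h₁ h₂ h₂
          · simp [h₁, h₂]
          · simp [h₁, Sesqui.oneSum]
          · simp [h₂, Sesqui.oneSum, H.adj_comm]
          · simp [Sesqui.oneSum]
        · rintro (x | y) hz
          · refine ⟨b, ?_⟩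
            have : x = a := by
              by_contra h
              exact hl x h hz
            simp [this]
          · exact ⟨y, by simp [y.2]⟩
    · refine ihG (hS.of_subset_range Sum.inl Sum.inl_injective (by simp [Sesqui.oneSum]) ?_)
      rintro (x | y) hz
      · exact ⟨x, rfl⟩
      · exact (hr ⟨y, hz⟩).elim

/-- Isomorphic copies of sesquicographs, embedded in a larger graph. -/
theorem IsSesquicograph.induce_of_range_eq {V W : Type u} {G : SimpleGraph V} {K : SimpleGraph W}
    (hK : IsSesquicograph K) {f : W → V} (hf : Function.Injective f)
    (h : ∀ x y, G.Adj (f x) (f y) ↔ K.Adj x y) {S : Set V} (hS : range f = S) :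
    IsSesquicograph (G.induce S) := by
  subst hS
  exact .iso ⟨Equiv.ofInjective f hf, h _ _⟩ hK

theorem injective_sumElim_val {V : Type u} {X Y : Set V} (h : Disjoint X Y) :
    Function.Injective (Sum.elim (Subtype.val : X → V) (Subtype.val : Y → V)) :=
  Subtype.val_injective.sumElim Subtype.val_injective
    fun x y hxy => h.ne_of_mem x.2 y.2 hxy

theorem isSesquicograph_induce {V : Type u} [Finite V] {G : SimpleGraph V}
    (hG : ¬ ∃ S, IsUnsplit G S) (S : Set V) (hS : S.Nonempty) :
    IsSesquicograph (G.induce S) := by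
  induction S using WellFoundedLT.induction with
  | ind S ih =>
  have proper : ∀ X ⊆ S, (S \ X).Nonempty → X < S := fun X hX hY =>
    hX.ssubset_of_ne (by rintro rfl; simp at hY)
  by_cases hnt : S.Nontrivial
  swap
  · rw [not_nontrivial_iff] at hnt
    obtain ⟨x, hx⟩ := hS
    refine IsSesquicograph.single.induce_of_range_eq (f := fun _ => x) (fun _ _ _ => rfl)
      (by simp) ?_
    rw [range_const, hnt.eq_singleton_of_mem hx]
  by_cases hco : IsLinked (fun x y => ¬ G.Adj x y) S
  swap
  · simp only [IsLinked, not_forall, not_exists, not_and, not_not] at hco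
    obtain ⟨X, hXS, hX, hY, hXY⟩ := hco
    refine IsSesquicograph.induce_of_range_eq
      (.join (ih X (proper X hXS hY) hX) (ih _ (proper _ sdiff_subset ?_) hY))
      (injective_sumElim_val disjoint_sdiff_right) ?_ ?_
    · simpa [inter_eq_self_of_subset_right hXS] using hX
    · rintro (⟨x, hx⟩ | ⟨x, hx⟩) (⟨y, hy⟩ | ⟨y, hy⟩) <;> simp [Sesqui.join]
      · exact hXY x hx y hy
      · exact (hXY y hy x hx).symm
    · rw [Sum.elim_range, Subtype.range_coe, Subtype.range_coe, union_sdiff_cancel hXS]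
  have hl := fun h => hG ⟨S, hnt, hco, h⟩
  simp only [imp_false, IsLinked, not_forall, not_exists, not_and] at hl
  obtain ⟨T, hT, X, hXS, hX, hY, hXY⟩ := hl
  by_cases hTS : ∃ t ∈ T, t ∈ S
  · obtain ⟨t, htT, htS⟩ := hTS
    obtain rfl : T = {t} := hT.eq_singleton_of_mem htT
    have hX' : insert t X < S := by
      refine proper _ (insert_subset htS (hXS.trans sdiff_subset)) ?_
      obtain ⟨y, hy⟩ := hY
      exact ⟨y, hy.1.1, fun h => h.elim hy.1.2 hy.2⟩
    have hY' : insert t ((S \ {t}) \ X) < S := by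
      refine proper _ (insert_subset htS (sdiff_subset.trans sdiff_subset)) ?_
      obtain ⟨x, hx⟩ := hX
      exact ⟨x, (hXS hx).1, fun h => h.elim (hXS hx).2 fun h => h.2 hx⟩
    have key : ∀ x ∈ insert t X, ∀ y ∈ insert t ((S \ {t}) \ X), y ≠ t →
        (G.Adj x y ↔ x = t ∧ G.Adj t y) := by
      intro x hx y hy hyt
      have hy := hy.resolve_left hyt
      rcases hx with rfl | hx
      · simp
      · refine ⟨fun h => (hXY x hx y hy h).elim, ?_⟩
        rintro ⟨rfl, h⟩
        exact h
    refine IsSesquicograph.induce_of_range_eq (f := Sum.elim Subtype.val fun y => y.1.1)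
      (.oneSum ⟨t, mem_insert _ _⟩ ⟨t, mem_insert _ _⟩ (ih _ hX' (insert_nonempty _ _))
        (ih _ hY' (insert_nonempty _ _))) ?_ ?_ ?_
    · refine Subtype.val_injective.sumElim
        (Subtype.val_injective.comp Subtype.val_injective) ?_
      rintro ⟨x, hx⟩ ⟨⟨y, hy⟩, hyt⟩ (rfl : x = y)
      have hy := hy.resolve_left fun h => hyt (Subtype.ext h)
      exact hx.elim hy.1.2 hy.2
    · rintro (⟨x, hx⟩ | ⟨⟨x, hx⟩, hx'⟩) (⟨y, hy⟩ | ⟨⟨y, hy⟩, hy'⟩) <;> simp [Sesqui.oneSum]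
      · exact key x hx y hy fun h => hy' (Subtype.ext h)
      · rw [G.adj_comm]
        exact key y hy x hx fun h => hx' (Subtype.ext h)
    · apply subset_antisymm
      · rintro _ ⟨x | x, rfl⟩
        exacts [hX'.1 x.2, hY'.1 x.1.2]
      · intro x hx
        by_cases h : x = t
        · exact ⟨.inl ⟨t, mem_insert _ _⟩, h.symm⟩
        by_cases h' : x ∈ X
        · exact ⟨.inl ⟨x, mem_insert_of_mem _ h'⟩, rfl⟩
        · exact ⟨.inr ⟨⟨x, mem_insert_of_mem _ ⟨⟨hx, h⟩, h'⟩⟩,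
            fun e => h (congrArg Subtype.val e)⟩, rfl⟩
  · have e : S \ T = S := sdiff_eq_left.2 (disjoint_right.2 fun x hx hxS => hTS ⟨x, hx, hxS⟩)
    rw [e] at hXS hY hXY
    refine IsSesquicograph.induce_of_range_eq
      (.zeroSum (ih X (proper X hXS hY) hX) (ih _ (proper _ sdiff_subset ?_) hY))
      (injective_sumElim_val disjoint_sdiff_right) ?_ ?_
    · simpa [inter_eq_self_of_subset_right hXS] using hX
    · rintro (⟨x, hx⟩ | ⟨x, hx⟩) (⟨y, hy⟩ | ⟨y, hy⟩) <;> simp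
      · exact hXY x hx y hy
      · exact fun h => hXY y hy x hx h.symm
    · rw [Sum.elim_range, Subtype.range_coe, Subtype.range_coe, union_sdiff_cancel hXS]

theorem isSesquicograph_iff {V : Type u} [Finite V] [Nonempty V] {G : SimpleGraph V} :
    IsSesquicograph G ↔ ¬ ∃ S, IsUnsplit G S :=
  ⟨IsSesquicograph.not_isUnsplit, fun h =>
    .iso G.induceUnivIso (isSesquicograph_induce h univ univ_nonempty)⟩

/-! ### Induced minors -/

theorem contractEdge_adj {V : Type u} {G : SimpleGraph V} {u v : V} {x y : {x : V // x ≠ v}} :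
    (contractEdge G u v).Adj x y ↔ (x : V) ≠ y ∧
      (G.Adj x y ∨ (x : V) = u ∧ G.Adj v y ∨ (y : V) = u ∧ G.Adj v x) := by
  simp only [contractEdge, SimpleGraph.fromRel_adj, ne_eq, Subtype.ext_iff, G.adj_comm y x]
  tauto

/-- If neither end of the contracted edge is pendant at the other, adding `v` to an unsplit set
that contains `u` keeps it unsplit: non-neighbours of the contracted vertex are non-neighbours of both
ends, and both ends lie on the same side of any separation. -/
theorem exists_isUnsplit_of_contractEdge {V : Type u} {G : SimpleGraph V} {u v : V}
    (huv : G.Adj u v) (h : ∃ S, IsUnsplit (contractEdge G u v) S) : ∃ S, IsUnsplit G S := by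
  obtain ⟨S, hS⟩ := h
  have hval : InjOn (Subtype.val : {x : V // x ≠ v} → V) S := Subtype.val_injective.injOn
  by_cases huS : ⟨u, huv.ne⟩ ∈ S
  swap
  · refine ⟨_, hS.image hval fun x hx y hy => ?_⟩
    have hxu : (x : V) ≠ u := fun e => huS (by convert hx; exact e.symm)
    have hyu : (y : V) ≠ u := fun e => huS (by convert hy; exact e.symm)
    simp only [contractEdge_adj, hxu, hyu, false_and, or_false]
    exact ⟨fun h => ⟨h.ne, h⟩, And.right⟩
  -- If one end of the edge is pendant, contracting the edge amounts to deleting that end.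
  by_cases hv : ∀ y ∈ S, G.Adj v y → (y : V) = u
  · refine ⟨_, hS.image hval fun x hx y hy => ?_⟩
    rw [contractEdge_adj]
    refine ⟨fun h => ⟨h.ne, .inl h⟩, ?_⟩
    rintro ⟨hne, h | ⟨h₁, h₂⟩ | ⟨h₁, h₂⟩⟩
    · exact h
    · exact (hne (h₁.trans (hv y hy h₂).symm)).elim
    · exact (hne ((hv x hx h₂).trans h₁.symm)).elim
  by_cases hu : ∀ y ∈ S, ¬ G.Adj u y
  · classical
    refine ⟨_, hS.image (f := fun x : {x : V // x ≠ v} => if (x : V) = u then v else x) ?_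
      fun x hx y hy => ?_⟩
    · intro x _ y _ hxy
      dsimp only at hxy
      have := x.2
      have := y.2
      apply Subtype.ext
      split_ifs at hxy <;> grind
    · rw [contractEdge_adj]
      have hx' := hu x hx
      have hy' := hu y hy
      have := huv.ne
      split_ifs with h₁ h₂ h₂
      · simp [h₁, h₂]
      · rw [h₁]; grind
      · rw [h₂, G.adj_comm _ v, G.adj_comm _ u]; grind
      · simp only [h₁, h₂, false_and, or_false]
        exact ⟨fun h => ⟨h.ne, h⟩, And.right⟩
  push Not at hv hu
  -- Otherwise both ends have another neighbour, and the edge can be put back.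
  let S' : Set V := insert v (Subtype.val '' S)
  have hS' : ∀ z : {x : V // x ≠ v}, (z : V) ∈ S' ↔ z ∈ S := fun z => by
    simp [S', z.2]
  refine ⟨S', (hS.nontrivial.image Subtype.val_injective).mono (subset_insert _ _), ?_, ?_⟩
  · intro X hX hX₀ hY₀
    by_contra hXY
    push Not at hXY
    have hvS' : v ∈ S' := mem_insert _ _
    -- A non-neighbour of the contracted vertex is a non-neighbour of both ends of the edge.
    obtain ⟨q, hqS, hvq⟩ : ∃ q ∈ S, ¬ G.Adj v q := by
      obtain ⟨z, hzS, hzu⟩ := hS.nontrivial.exists_ne ⟨u, huv.ne⟩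
      obtain ⟨p, rfl, q, hq, hpq⟩ := hS.coLinked {⟨u, huv.ne⟩} (by simpa using huS)
        (singleton_nonempty _) ⟨z, hzS, hzu⟩
      rw [contractEdge_adj] at hpq
      exact ⟨q, hq.1, fun h => hpq ⟨fun e => hq.2 (Subtype.ext e.symm), .inr (.inl ⟨rfl, h⟩)⟩⟩
    have hqX : (q : V) ∈ X ↔ v ∈ X := by
      constructor
      · intro h
        by_contra hvX
        exact hvq (hXY q h v ⟨hvS', hvX⟩).symm
      · intro h
        by_contra hq
        exact hvq (hXY v h q ⟨(hS' q).2 hqS, hq⟩)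
    obtain ⟨p, hp, r, hr, hpr⟩ := hS.coLinked (S ∩ Subtype.val ⁻¹' X) inter_subset_left
      (by
        obtain ⟨x, hx⟩ := hX₀
        by_cases hxv : x = v
        · exact ⟨q, hqS, hqX.2 (hxv ▸ hx)⟩
        · exact ⟨⟨x, hxv⟩, (hS' ⟨x, hxv⟩).1 (hX hx), hx⟩)
      (by
        obtain ⟨x, hx⟩ := hY₀
        by_cases hxv : x = v
        · exact ⟨q, hqS, fun h => hx.2 (hxv ▸ hqX.1 h.2)⟩
        · exact ⟨⟨x, hxv⟩, (hS' ⟨x, hxv⟩).1 hx.1, fun h => hx.2 h.2⟩)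
    have := hXY p hp.2 r ⟨(hS' r).2 hr.1, fun h => hr.2 ⟨hr.1, h⟩⟩
    exact hpr (contractEdge_adj.2 ⟨this.ne, .inl this⟩)
  · intro T hT X hX hX₀ hY₀
    by_contra hXY
    push Not at hXY
    have key : ∀ X Y : Set V, X ∪ Y = S' \ T → X.Nonempty → Y.Nonempty → Disjoint X Y →
        (∀ x ∈ X, ∀ y ∈ Y, ¬ G.Adj x y) → (v ∈ X ∨ v ∈ T ∧ u ∉ Y) → False := by
      rintro X Y hXYS ⟨x, hx⟩ ⟨y, hy⟩ hdis hXY hv'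
      have hXY_mem : ∀ z, z ∈ X ∨ z ∈ Y ↔ z ∈ S' ∧ z ∉ T := fun z => by
        rw [← mem_union, hXYS, mem_sdiff]
      have huS' : u ∈ S' := (hS' ⟨u, huv.ne⟩).2 huS
      have huY : u ∉ Y := fun h => hv'.elim (fun h' => hXY v h' u h huv.symm) fun h' => h'.2 h
      have hvY : v ∉ Y := fun h => hv'.elim (fun h' => hdis.ne_of_mem h' h rfl)
        fun h' => ((hXY_mem v).1 (.inr h)).2 h'.1
      have hYu : ∀ z : V, z ∈ Y → z ≠ u := fun z hz h => huY (h ▸ hz)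
      have hYS : ∀ z (hz : z ∈ Y), ⟨z, fun h => hvY (h ▸ hz)⟩ ∈ S := fun z hz =>
        (hS' _).1 ((hXY_mem z).1 (.inr hz)).1
      rcases hv' with hvX | ⟨hvT, -⟩
      · have hX₀ : (S ∩ Subtype.val ⁻¹' X).Nonempty := by
          by_cases huX : u ∈ X
          · exact ⟨⟨u, huv.ne⟩, huS, huX⟩
          · have huT : u ∈ T := by
              by_contra h
              exact ((hXY_mem u).2 ⟨huS', h⟩).elim huX huY
            obtain ⟨z, hzS, hvz, hzu⟩ := hv
            refine ⟨z, hzS, ?_⟩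
            exact ((hXY_mem z).2 ⟨(hS' z).2 hzS, fun h => hzu (hT h huT)⟩).resolve_right
              fun h => hXY v hvX z h hvz
        obtain ⟨p, hp, q, hq, hpq⟩ := hS.linked (Subtype.val ⁻¹' T)
          (hT.preimage Subtype.val_injective) (S ∩ Subtype.val ⁻¹' X)
          (fun z hz => ⟨hz.1, ((hXY_mem z).1 (.inl hz.2)).2⟩) hX₀
          ⟨⟨y, fun h => hvY (h ▸ hy)⟩, ⟨hYS y hy, ((hXY_mem y).1 (.inr hy)).2⟩,
            fun h => hdis.ne_of_mem h.2 hy rfl⟩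
        have hqY : (q : V) ∈ Y := ((hXY_mem q).2 ⟨(hS' q).2 hq.1.1, hq.1.2⟩).resolve_left
          fun h => hq.2 ⟨hq.1.1, h⟩
        rcases (contractEdge_adj.1 hpq).2 with h | ⟨-, h⟩ | ⟨h, -⟩
        · exact hXY p hp.2 q hqY h
        · exact hXY v hvX q hqY h
        · exact hYu q hqY h
      · have hTv : ∀ z ∈ T, z = v := fun z hz => hT hz hvT
        have huX : u ∈ X := ((hXY_mem u).2 ⟨huS', fun h => huv.ne (hTv u h)⟩).resolve_right huY
        have hSXY : ∀ z : {x : V // x ≠ v}, z ∈ S → (z : V) ∈ X ∨ (z : V) ∈ Y := fun z hz =>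
          (hXY_mem z).2 ⟨(hS' z).2 hz, fun h => z.2 (hTv z h)⟩
        obtain ⟨z, hzS, huz⟩ := hu
        obtain ⟨p, hp, q, hq, hpq⟩ := hS.linked {⟨u, huv.ne⟩} subsingleton_singleton
          ((S \ {⟨u, huv.ne⟩}) ∩ Subtype.val ⁻¹' X) inter_subset_left
          ⟨z, ⟨hzS, fun h => huz.ne (congrArg Subtype.val h).symm⟩,
            (hSXY z hzS).resolve_right fun h => hXY u huX z h huz⟩
          ⟨⟨y, fun h => hvY (h ▸ hy)⟩, ⟨hYS y hy, fun h => hYu y hy (congrArg Subtype.val h)⟩,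
            fun h => hdis.ne_of_mem h.2 hy rfl⟩
        have hqY : (q : V) ∈ Y := (hSXY q hq.1.1).resolve_left fun h => hq.2 ⟨hq.1, h⟩
        rcases (contractEdge_adj.1 hpq).2 with h | ⟨h, -⟩ | ⟨h, -⟩
        · exact hXY p hp.2 q hqY h
        · exact hp.1.2 (Subtype.ext h)
        · exact hYu q hqY h
    by_cases hvT : v ∈ T
    · by_cases huX : u ∈ X
      · exact key X _ (union_sdiff_cancel hX) hX₀ hY₀ disjoint_sdiff_right hXY
          (.inr ⟨hvT, fun h => h.2 huX⟩)
      · exact key _ X (sdiff_union_of_subset hX) hY₀ hX₀ disjoint_sdiff_left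
          (fun x hx y hy h => hXY y hy x hx h.symm) (.inr ⟨hvT, huX⟩)
    · by_cases hvX : v ∈ X
      · exact key X _ (union_sdiff_cancel hX) hX₀ hY₀ disjoint_sdiff_right hXY (.inl hvX)
      · exact key _ X (sdiff_union_of_subset hX) hY₀ hX₀ disjoint_sdiff_left
          (fun x hx y hy h => hXY y hy x hx h.symm) (.inl ⟨⟨mem_insert _ _, hvT⟩, hvX⟩)

theorem exists_isUnsplit_of_deleteVertex {V : Type u} {G : SimpleGraph V} {v : V}
    (h : ∃ S, IsUnsplit (deleteVertex G v) S) : ∃ S, IsUnsplit G S := by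
  obtain ⟨S, hS⟩ := h
  exact ⟨_, hS.image (f := Subtype.val) Subtype.val_injective.injOn fun _ _ _ _ => Iff.rfl⟩

theorem HasInducedMinor.exists_isUnsplit {V : Type u} {W : Type w} {G : SimpleGraph V}
    {H : SimpleGraph W} (h : HasInducedMinor G H) (hH : ∃ S, IsUnsplit H S) :
    ∃ S, IsUnsplit G S := by
  induction h with
  | iso e =>
    obtain ⟨S, hS⟩ := hH
    exact ⟨_, hS.image (f := e.symm) e.symm.injective.injOn fun _ _ _ _ => e.symm.map_adj_iff⟩
  | delete v _ ih => exact exists_isUnsplit_of_deleteVertex (ih hH)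
  | contract u v huv _ ih => exact exists_isUnsplit_of_contractEdge huv (ih hH)

theorem hasInducedMinor_of_embedding {V : Type u} {W : Type w} [Finite V] {G : SimpleGraph V}
    {H : SimpleGraph W} (f : H ↪g G) : HasInducedMinor G H := by
  induction hn : Nat.card V using Nat.strong_induction_on generalizing V with
  | _ n ih =>
  by_cases hf : Function.Surjective f
  · exact .iso (RelIso.ofSurjective f hf).symm
  · simp only [Function.Surjective, not_forall, not_exists] at hf
    obtain ⟨v, hv⟩ := hf
    refine .delete v (ih _ ?_ (G := deleteVertex G v)
      ⟨⟨fun x => ⟨f x, hv x⟩, fun x y h => f.injective (congrArg Subtype.val h)⟩, ?_⟩ rfl)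
    · rw [← hn]
      exact Finite.card_subtype_lt (x := v) (by simp)
    · exact f.map_adj_iff

/-! ### The seven graphs are unsplit -/

instance : DecidableRel C5.Adj := inferInstanceAs (DecidableRel (SimpleGraph.cycleGraph 5).Adj)
instance : DecidableRel P5c.Adj := fun x y =>
  decidable_of_iff (x ≠ y ∧ ¬ ((x : ℕ) + 1 = y ∨ (y : ℕ) + 1 = x)) (by
    simp [P5c, SimpleGraph.pathGraph_adj])
instance : DecidableRel H1.Adj := fun x y =>
  decidable_of_iff ((SimpleGraph.cycleGraph 6).Adj x y ∨
    s(x, y) ∈ ({s(1, 4), s(4, 2), s(2, 5), s(5, 1)} : Finset (Sym2 (Fin 6))) ∧ x ≠ y) (by simp [H1])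
instance : DecidableRel H2.Adj := fun x y =>
  decidable_of_iff ((SimpleGraph.cycleGraph 6).Adj x y ∨
    s(x, y) ∈ ({s(1, 4), s(4, 2), s(2, 5)} : Finset (Sym2 (Fin 6))) ∧ x ≠ y) (by simp [H2])
instance : DecidableRel H3.Adj := fun x y =>
  decidable_of_iff ((SimpleGraph.cycleGraph 6).Adj x y ∨
    s(x, y) ∈ ({s(1, 4), s(2, 5)} : Finset (Sym2 (Fin 6))) ∧ x ≠ y) (by simp [H3])
instance : DecidableRel H4.Adj := fun x y =>
  decidable_of_iff ((SimpleGraph.cycleGraph 6).Adj x y ∨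
    s(x, y) ∈ ({s(5, 1), s(1, 4), s(4, 2)} : Finset (Sym2 (Fin 6))) ∧ x ≠ y) (by simp [H4])
instance : DecidableRel H5.Adj := fun x y =>
  decidable_of_iff ((SimpleGraph.cycleGraph 6).Adj x y ∨
    s(x, y) ∈ ({s(1, 5), s(5, 3), s(3, 1)} : Finset (Sym2 (Fin 6))) ∧ x ≠ y) (by simp [H5])
theorem isUnsplit_univ_of_finset {V : Type u} [Fintype V] [DecidableEq V] [Nontrivial V]
    (G : SimpleGraph V)
    (hco : ∀ X : Finset V, X.Nonempty → Xᶜ.Nonempty → ∃ x ∈ X, ∃ y ∈ Xᶜ, ¬ G.Adj x y)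
    (h : ∀ X : Finset V, X.Nonempty → Xᶜ.Nonempty → ∃ x ∈ X, ∃ y ∈ Xᶜ, G.Adj x y)
    (h' : ∀ t, ∀ X ⊆ {t}ᶜ, X.Nonempty → ({t}ᶜ \ X).Nonempty →
      ∃ x ∈ X, ∃ y ∈ ({t}ᶜ : Finset V) \ X, G.Adj x y) : ∃ S, IsUnsplit G S := by
  classical
  refine ⟨univ, nontrivial_univ, ?_, ?_⟩
  · rintro X -
    have := hco X.toFinset
    simpa [Set.Nonempty, Finset.Nonempty] using this
  · intro T hT
    rcases hT.eq_empty_or_singleton with rfl | ⟨t, rfl⟩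
    · rintro X -
      have := h X.toFinset
      simpa [Set.Nonempty, Finset.Nonempty] using this
    · intro X hX
      have := h' t X.toFinset (fun x hx => by simpa using hX (Set.mem_toFinset.1 hx))
      simpa [Set.Nonempty, Finset.Nonempty, and_assoc] using this
set_option maxRecDepth 100000 in
theorem exists_isUnsplit_C5 : ∃ S, IsUnsplit C5 S :=
  isUnsplit_univ_of_finset _ (by decide) (by decide) (by decide)

set_option maxRecDepth 100000 in
theorem exists_isUnsplit_P5c : ∃ S, IsUnsplit P5c S :=
  isUnsplit_univ_of_finset _ (by decide) (by decide) (by decide)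

set_option maxRecDepth 100000 in
theorem exists_isUnsplit_H1 : ∃ S, IsUnsplit H1 S :=
  isUnsplit_univ_of_finset _ (by decide) (by decide) (by decide)

set_option maxRecDepth 100000 in
theorem exists_isUnsplit_H2 : ∃ S, IsUnsplit H2 S :=
  isUnsplit_univ_of_finset _ (by decide) (by decide) (by decide)

set_option maxRecDepth 100000 in
theorem exists_isUnsplit_H3 : ∃ S, IsUnsplit H3 S :=
  isUnsplit_univ_of_finset _ (by decide) (by decide) (by decide)

set_option maxRecDepth 100000 in
theorem exists_isUnsplit_H4 : ∃ S, IsUnsplit H4 S :=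
  isUnsplit_univ_of_finset _ (by decide) (by decide) (by decide)

set_option maxRecDepth 100000 in
theorem exists_isUnsplit_H5 : ∃ S, IsUnsplit H5 S :=
  isUnsplit_univ_of_finset _ (by decide) (by decide) (by decide)

/-! ### Recognizing the seven graphs -/

/-- At least one of the seven graphs is an induced minor of `G`. -/
def HasForbiddenMinor {V : Type u} (G : SimpleGraph V) : Prop :=
  HasInducedMinor G C5 ∨ HasInducedMinor G P5c ∨ HasInducedMinor G H1 ∨ HasInducedMinor G H2 ∨
    HasInducedMinor G H3 ∨ HasInducedMinor G H4 ∨ HasInducedMinor G H5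

/-- Matching adjacency already forces `f` to be injective, except on pairs of vertices of `H` with
the same neighbours. -/
theorem hasInducedMinor_of_tuple {V : Type u} [Finite V] {G : SimpleGraph V} {n : ℕ}
    {H : SimpleGraph (Fin n)} (f : Fin n → V)
    (h : ∀ i j, i < j → (G.Adj (f i) (f j) ↔ H.Adj i j))
    (hne : ∀ i j, i < j → (∀ k, H.Adj i k ↔ H.Adj j k) → f i ≠ f j) : HasInducedMinor G H := by
  have h' : ∀ i j, G.Adj (f i) (f j) ↔ H.Adj i j := by
    intro i j
    rcases lt_trichotomy i j with hij | rfl | hij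
    · exact h i j hij
    · simp
    · rw [G.adj_comm, H.adj_comm]
      exact h j i hij
  have hinj : ∀ i j, i < j → f i ≠ f j := fun i j hij he =>
    hne i j hij (fun k => by rw [← h', ← h', he]) he
  refine hasInducedMinor_of_embedding ⟨⟨f, fun i j he => ?_⟩, h' _ _⟩
  rcases lt_trichotomy i j with hij | rfl | hij
  exacts [(hinj i j hij he).elim, rfl, (hinj j i hij he.symm).elim]

theorem hasForbiddenMinor_of_cycle {V : Type u} [Finite V] {G : SimpleGraph V} {a b c d e : V}
    (hab : G.Adj a b) (hbc : G.Adj b c) (hcd : G.Adj c d) (hde : G.Adj d e) (hae : G.Adj a e)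
    (hac : ¬ G.Adj a c) (had : ¬ G.Adj a d) (hbd : ¬ G.Adj b d) (hbe : ¬ G.Adj b e)
    (hce : ¬ G.Adj c e) : HasForbiddenMinor G := by
  refine .inl (hasInducedMinor_of_tuple ![a, b, c, d, e] ?_ ?_)
  · intro i j hij
    fin_cases i <;> fin_cases j <;>
    first
    | exact absurd hij (by decide)
    | exact iff_of_true (by assumption) (by decide)
    | exact iff_of_false (by assumption) (by decide)
  · have twinFree : ∀ i j : Fin 5, i < j → ¬ ∀ k, C5.Adj i k ↔ C5.Adj j k := by decide
    exact fun i j hij h => (twinFree i j hij h).elim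

/-- The complement of the path `a b c d e` is an induced subgraph. -/
theorem hasForbiddenMinor_of_coPath {V : Type u} [Finite V] {G : SimpleGraph V} {a b c d e : V}
    (hab : ¬ G.Adj a b) (hbc : ¬ G.Adj b c) (hcd : ¬ G.Adj c d) (hde : ¬ G.Adj d e)
    (hac : G.Adj a c) (had : G.Adj a d) (hae : G.Adj a e) (hbd : G.Adj b d) (hbe : G.Adj b e)
    (hce : G.Adj c e) : HasForbiddenMinor G := by
  refine .inr (.inl (hasInducedMinor_of_tuple ![a, b, c, d, e] ?_ ?_))
  · intro i j hij
    fin_cases i <;> fin_cases j <;>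
    first
    | exact absurd hij (by decide)
    | exact iff_of_true (by assumption) (by decide)
    | exact iff_of_false (by assumption) (by decide)
  · have twinFree : ∀ i j : Fin 5, i < j → ¬ ∀ k, P5c.Adj i k ↔ P5c.Adj j k := by decide
    exact fun i j hij h => (twinFree i j hij h).elim

/-- The vertices `v` and `m` both see exactly one of the pairs `n, n'` and `b, b'`, which are complete
to each other. The number of pairs that are edges decides between `H1`, `H2` and `H3`. -/
theorem hasForbiddenMinor_of_doubled_pairs {V : Type u} [Finite V] {G : SimpleGraph V}
    {v m n n' b b' : V} (hvn : G.Adj v n) (hvn' : G.Adj v n') (hmb : G.Adj m b)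
    (hmb' : G.Adj m b') (hnb : G.Adj n b) (hnb' : G.Adj n b') (hnb₂ : G.Adj n' b)
    (hnb₂' : G.Adj n' b') (hvm : ¬ G.Adj v m) (hvb : ¬ G.Adj v b) (hvb' : ¬ G.Adj v b')
    (hmn : ¬ G.Adj m n) (hmn' : ¬ G.Adj m n') (hn : n ≠ n') (hb : b ≠ b') :
    HasForbiddenMinor G := by
  have twins : ∀ i j : Fin 6, i < j →
      ((∀ k, H1.Adj i k ↔ H1.Adj j k) ∨ (∀ k, H2.Adj i k ↔ H2.Adj j k) ∨
        (∀ k, H3.Adj i k ↔ H3.Adj j k)) → i = 1 ∧ j = 5 ∨ i = 2 ∧ j = 4 := by decide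
  have distinct : ∀ i j : Fin 6, i = 1 ∧ j = 5 ∨ i = 2 ∧ j = 4 →
      ![v, n, b, m, b', n'] i ≠ ![v, n, b, m, b', n'] j ∧
      ![m, b, n, v, n', b'] i ≠ ![m, b, n, v, n', b'] j := by
    rintro i j (⟨rfl, rfl⟩ | ⟨rfl, rfl⟩)
    exacts [⟨hn, hb⟩, ⟨hb, hn⟩]
  have hmv := fun h : G.Adj m v => hvm h.symm
  have hbv := fun h : G.Adj b v => hvb h.symm
  have hbv' := fun h : G.Adj b' v => hvb' h.symm
  have hnm := fun h : G.Adj n m => hmn h.symm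
  have hnm' := fun h : G.Adj n' m => hmn' h.symm
  have := hmb.symm
  have := hmb'.symm
  have := hnb.symm
  have := hnb'.symm
  have := hnb₂.symm
  have := hnb₂'.symm
  have := hvn.symm
  have := hvn'.symm
  have hbb := G.adj_comm b b'
  by_cases h₁ : G.Adj n n' <;> by_cases h₂ : G.Adj b b' <;> rw [hbb] at h₂
  · refine .inr (.inr (.inl (hasInducedMinor_of_tuple ![v, n, b, m, b', n'] ?_
      fun i j hij h => (distinct i j (twins i j hij (.inl h))).1)))
    have := h₂.symm
    intro i j hij
    fin_cases i <;> fin_cases j <;>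
    first
    | exact absurd hij (by decide)
    | exact iff_of_true (by assumption) (by decide)
    | exact iff_of_false (by assumption) (by decide)
  · refine .inr (.inr (.inr (.inl (hasInducedMinor_of_tuple ![m, b, n, v, n', b'] ?_
      fun i j hij h => (distinct i j (twins i j hij (.inr (.inl h)))).2))))
    have h₃ := fun h : G.Adj b b' => h₂ h.symm
    intro i j hij
    fin_cases i <;> fin_cases j <;>
    first
    | exact absurd hij (by decide)
    | exact iff_of_true (by assumption) (by decide)
    | exact iff_of_false (by assumption) (by decide)
  · refine .inr (.inr (.inr (.inl (hasInducedMinor_of_tuple ![v, n, b, m, b', n'] ?_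
      fun i j hij h => (distinct i j (twins i j hij (.inr (.inl h)))).1))))
    have := h₂.symm
    intro i j hij
    fin_cases i <;> fin_cases j <;>
    first
    | exact absurd hij (by decide)
    | exact iff_of_true (by assumption) (by decide)
    | exact iff_of_false (by assumption) (by decide)
  · refine .inr (.inr (.inr (.inr (.inl (hasInducedMinor_of_tuple ![v, n, b, m, b', n'] ?_
      fun i j hij h => (distinct i j (twins i j hij (.inr (.inr h)))).1)))))
    have h₃ := fun h : G.Adj b b' => h₂ h.symm
    intro i j hij
    fin_cases i <;> fin_cases j <;>
    first
    | exact absurd hij (by decide)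
    | exact iff_of_true (by assumption) (by decide)
    | exact iff_of_false (by assumption) (by decide)

theorem hasForbiddenMinor_of_H4 {V : Type u} [Finite V] {G : SimpleGraph V} {a b c d e f : V}
    (hab : G.Adj a b) (hbc : G.Adj b c) (hcd : G.Adj c d) (hde : G.Adj d e) (hef : G.Adj e f)
    (haf : G.Adj a f) (hbf : G.Adj b f) (hbe : G.Adj b e) (hce : G.Adj c e)
    (hac : ¬ G.Adj a c) (had : ¬ G.Adj a d) (hae : ¬ G.Adj a e) (hbd : ¬ G.Adj b d)
    (hcf : ¬ G.Adj c f) (hdf : ¬ G.Adj d f) : HasForbiddenMinor G := by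
  refine .inr (.inr (.inr (.inr (.inr (.inl (hasInducedMinor_of_tuple ![a, b, c, d, e, f] ?_ ?_))))))
  · intro i j hij
    fin_cases i <;> fin_cases j <;>
    first
    | exact absurd hij (by decide)
    | exact iff_of_true (by assumption) (by decide)
    | exact iff_of_false (by assumption) (by decide)
  · have twinFree : ∀ i j : Fin 6, i < j → ¬ ∀ k, H4.Adj i k ↔ H4.Adj j k := by decide
    exact fun i j hij h => (twinFree i j hij h).elim

theorem hasForbiddenMinor_of_H5 {V : Type u} [Finite V] {G : SimpleGraph V} {a b c d e f : V}
    (hab : G.Adj a b) (hbc : G.Adj b c) (hcd : G.Adj c d) (hde : G.Adj d e) (hef : G.Adj e f)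
    (haf : G.Adj a f) (hbf : G.Adj b f) (hdf : G.Adj d f) (hbd : G.Adj b d)
    (hac : ¬ G.Adj a c) (had : ¬ G.Adj a d) (hae : ¬ G.Adj a e) (hbe : ¬ G.Adj b e)
    (hce : ¬ G.Adj c e) (hcf : ¬ G.Adj c f) : HasForbiddenMinor G := by
  refine .inr (.inr (.inr (.inr (.inr (.inr (hasInducedMinor_of_tuple ![a, b, c, d, e, f] ?_ ?_))))))
  · intro i j hij
    fin_cases i <;> fin_cases j <;>
    first
    | exact absurd hij (by decide)
    | exact iff_of_true (by assumption) (by decide)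
    | exact iff_of_false (by assumption) (by decide)
  · have twinFree : ∀ i j : Fin 6, i < j → ¬ ∀ k, H5.Adj i k ↔ H5.Adj j k := by decide
    exact fun i j hij h => (twinFree i j hij h).elim

/-! ### Joins with one vertex added -/

/-- Two non-neighbours `m, m'` of `v` with incomparable neighbourhoods in `N(v)`, below a vertex `b`
adjacent to everything but `v`, give `C5`, the complement of `P5`, or `H5`. -/
theorem hasForbiddenMinor_of_incomparable {V : Type u} [Finite V] {G : SimpleGraph V}
    {v m m' n n' b : V} (hvn : G.Adj v n) (hvn' : G.Adj v n') (hmn' : G.Adj m n')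
    (hm'n : G.Adj m' n) (hnb : G.Adj n b) (hnb' : G.Adj n' b) (hmb : G.Adj m b)
    (hmb' : G.Adj m' b) (hvm : ¬ G.Adj v m) (hvm' : ¬ G.Adj v m') (hvb : ¬ G.Adj v b)
    (hmn : ¬ G.Adj m n) (hm'n' : ¬ G.Adj m' n') : HasForbiddenMinor G := by
  by_cases hm : G.Adj m m' <;> by_cases hn : G.Adj n n'
  · apply hasForbiddenMinor_of_coPath (a := n) (b := m) (c := v) (d := m') (e := n') <;>
      first | assumption | (rw [G.adj_comm]; assumption)
  · apply hasForbiddenMinor_of_cycle (a := n) (b := v) (c := n') (d := m) (e := m') <;>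
      first | assumption | (rw [G.adj_comm]; assumption)
  · apply hasForbiddenMinor_of_H5 (a := v) (b := n') (c := m) (d := b) (e := m') (f := n) <;>
      first | assumption | (rw [G.adj_comm]; assumption)
  · apply hasForbiddenMinor_of_coPath (a := b) (b := v) (c := m') (d := n') (e := n) <;>
      first | assumption | (rw [G.adj_comm]; assumption)

/-- The configuration gives `H4` or the complement of `P5`, according to whether `n` and `n'` are
adjacent. -/
theorem hasForbiddenMinor_of_two_levels {V : Type u} [Finite V] {G : SimpleGraph V}
    {v b m m' n n' : V} (hvn : G.Adj v n) (hvn' : G.Adj v n') (hbm : G.Adj b m)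
    (hbm' : G.Adj b m') (hbn : G.Adj b n) (hbn' : G.Adj b n') (hm : G.Adj m m')
    (hm'n : G.Adj m' n) (hvb : ¬ G.Adj v b) (hvm : ¬ G.Adj v m) (hvm' : ¬ G.Adj v m')
    (hmn : ¬ G.Adj m n) (hmn' : ¬ G.Adj m n') (hm'n' : ¬ G.Adj m' n') :
    HasForbiddenMinor G := by
  by_cases hn : G.Adj n n'
  · apply hasForbiddenMinor_of_H4 (a := v) (b := n) (c := m') (d := m) (e := b) (f := n') <;>
      first | assumption | (rw [G.adj_comm]; assumption)
  · apply hasForbiddenMinor_of_coPath (a := b) (b := v) (c := m') (d := n') (e := n) <;>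
      first | assumption | (rw [G.adj_comm]; assumption)

/-- `IsUnsplit.coLinked` for `univ`, with the two sides given by a predicate. -/
theorem IsUnsplit.exists_coAdj {V : Type u} {G : SimpleGraph V} (hG : IsUnsplit G univ)
    (p : V → Prop) (h : ∃ x, p x) (h' : ∃ x, ¬ p x) : ∃ x y, p x ∧ ¬ p y ∧ ¬ G.Adj x y := by
  obtain ⟨x, hx, y, hy, hxy⟩ := hG.coLinked {x | p x} (subset_univ _) h
    (h'.imp fun x hx => ⟨trivial, hx⟩)
  exact ⟨x, y, hx, hy.2, hxy⟩

/-- `G - t` is connected: `IsUnsplit.linked` with the two sides given by a predicate. -/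
theorem IsUnsplit.exists_adj {V : Type u} {G : SimpleGraph V} (hG : IsUnsplit G univ) (t : V)
    (p : V → Prop) (h : ∃ x, x ≠ t ∧ p x) (h' : ∃ x, x ≠ t ∧ ¬ p x) :
    ∃ x y, x ≠ t ∧ y ≠ t ∧ p x ∧ ¬ p y ∧ G.Adj x y := by
  obtain ⟨x, hx, y, hy, hxy⟩ := hG.linked {t} subsingleton_singleton {x | x ≠ t ∧ p x}
    (fun x hx => ⟨trivial, hx.1⟩) h (h'.imp fun x hx => ⟨⟨trivial, hx.1⟩, fun h => hx.2 h.2⟩)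
  exact ⟨x, y, hx.1, hy.1.2, hx.2, fun h => hy.2 ⟨hy.1.2, h⟩, hxy⟩

theorem IsUnsplit.exists_adj_ne {V : Type u} {G : SimpleGraph V} (hG : IsUnsplit G univ) (v n : V)
    (h : ∃ x, x ≠ v ∧ x ≠ n) (hv : v ≠ n) : ∃ n', n' ≠ n ∧ G.Adj v n' := by
  obtain ⟨_, y, -, hy, rfl, -, h⟩ := hG.exists_adj n (· = v) ⟨v, hv, rfl⟩
    (h.imp fun x hx => ⟨hx.2, hx.1⟩)
  exact ⟨y, hy, h⟩

/-- The case of `G - v` being the join of `A` and `B` in which `v` has no neighbour in `B`. -/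
theorem hasForbiddenMinor_of_join_left {V : Type u} [Finite V] {G : SimpleGraph V}
    (hG : IsUnsplit G univ) {v : V} {A B : Set V} (hcov : ∀ z, z = v ∨ z ∈ A ∨ z ∈ B)
    (hB : B.Nonempty) (hvB : v ∉ B) (hAB : ∀ x ∈ A, ∀ y ∈ B, G.Adj x y)
    (hN : ∀ z, G.Adj v z → z ∈ A) : HasForbiddenMinor G := by
  obtain ⟨b, hb⟩ := hB
  have hvb : ∀ y ∈ B, ¬ G.Adj v y := fun y hy h => (hAB y (hN y h) y hy).ne rfl
  have hAB' : ∀ x ∈ A, x ∉ B := fun x hx h => (hAB x hx x h).ne rfl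
  have hbv : b ≠ v := fun h => hvB (h ▸ hb)
  obtain ⟨n, hvn⟩ : ∃ n, G.Adj v n := by
    obtain ⟨_, rfl, n, -, hvn⟩ := hG.linked ∅ subsingleton_empty {v} (by simp)
      (singleton_nonempty _) ⟨b, by simpa using hbv⟩
    exact ⟨n, hvn⟩
  have hnb : n ≠ b := fun h => hvb b hb (h ▸ hvn)
  obtain ⟨n', hnn', hvn'⟩ := hG.exists_adj_ne v n ⟨b, hbv, hnb.symm⟩ hvn.ne
  -- Among the non-neighbours of `v` in `A`, choose one with the most non-neighbours in `N(v)`.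
  obtain ⟨m, ⟨hmA, hvm⟩, hmax⟩ := Set.exists_max_image {m | m ∈ A ∧ ¬ G.Adj v m}
    (fun m => {z | G.Adj v z ∧ ¬ G.Adj m z}.ncard) (toFinite _) (by
      obtain ⟨x, y, hx, hy, hxy⟩ := hG.exists_coAdj (G.Adj v) ⟨n, hvn⟩ ⟨v, G.irrefl⟩
      refine ⟨y, ?_, hy⟩
      rcases hcov y with rfl | h | h
      exacts [(hxy hx.symm).elim, h, (hxy (hAB x (hN x hx) y h)).elim])
  by_contra hNot
  have hm : ∀ z, G.Adj v z → ¬ G.Adj m z := by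
    by_contra! h
    apply hNot
    obtain ⟨x, y, ⟨hvx, hmx⟩, hy, hxy⟩ := hG.exists_coAdj (fun z => G.Adj v z ∧ G.Adj m z) h
      ⟨v, fun h => G.irrefl h.1⟩
    have hxb := hAB x (hN x hvx) b hb
    by_cases hvy : G.Adj v y
    · exact hasForbiddenMinor_of_coPath (fun h => hvb b hb h.symm) hvm (fun h => hy ⟨hvy, h⟩)
        (fun h => hxy h.symm) (hAB m hmA b hb).symm (hAB y (hN y hvy) b hb).symm hxb.symm hvy hvx
        hmx
    have hyA : y ∈ A := by
      rcases hcov y with rfl | h | h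
      exacts [(hxy hvx.symm).elim, h, (hxy (hAB x (hN x hvx) y h)).elim]
    obtain ⟨z, hvz, hmz, hyz⟩ : ∃ z, G.Adj v z ∧ ¬ G.Adj m z ∧ G.Adj y z := by
      by_contra! h
      refine (hmax y ⟨hyA, hvy⟩).not_gt (ncard_lt_ncard ?_ (toFinite _))
      exact ⟨fun z hz => ⟨hz.1, h z hz.1 hz.2⟩,
        fun hle => (hle ⟨hvx, fun h => hxy h.symm⟩ : _ ∧ ¬ G.Adj m x).2 hmx⟩
    exact hasForbiddenMinor_of_incomparable hvz hvx hmx hyz (hAB z (hN z hvz) b hb) hxb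
      (hAB m hmA b hb) (hAB y hyA b hb) hvm hvy (hvb b hb) hmz fun h => hxy h.symm
  apply hNot
  by_cases hB' : ∃ b' ∈ B, b' ≠ b
  · obtain ⟨b', hb', hbb'⟩ := hB'
    exact hasForbiddenMinor_of_doubled_pairs hvn hvn' (hAB m hmA b hb) (hAB m hmA b' hb')
      (hAB n (hN n hvn) b hb) (hAB n (hN n hvn) b' hb') (hAB n' (hN n' hvn') b hb)
      (hAB n' (hN n' hvn') b' hb') hvm (hvb b hb) (hvb b' hb') (hm n hvn) (hm n' hvn')
      hnn'.symm hbb'.symm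
  push Not at hB'
  -- Otherwise `G - b` is connected, so some vertex of `A` without neighbours in `N(v)`
  -- has a neighbour in `A` that is not of this kind.
  obtain ⟨x, y, hxb, hyb, ⟨hxA, hvx, hx⟩, hy, hxy⟩ := hG.exists_adj b
    (fun z => z ∈ A ∧ ¬ G.Adj v z ∧ ∀ w, G.Adj v w → ¬ G.Adj z w)
    ⟨m, fun h => hAB' m hmA (h ▸ hb), hmA, hvm, hm⟩ ⟨v, hbv.symm, fun h => hvb b hb (hAB v h.1 b hb)⟩
  have hvy : ¬ G.Adj v y := fun h => hx y h hxy
  have hyA : y ∈ A := by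
    rcases hcov y with rfl | h | h
    exacts [(hvx hxy.symm).elim, h, (hyb (hB' y h)).elim]
  push Not at hy
  obtain ⟨w, hvw, hyw⟩ := hy hyA hvy
  by_cases hyN : ∃ w', G.Adj v w' ∧ ¬ G.Adj y w'
  · obtain ⟨w', hvw', hyw'⟩ := hyN
    exact hasForbiddenMinor_of_two_levels hvw hvw' (hAB x hxA b hb).symm (hAB y hyA b hb).symm
      (hAB w (hN w hvw) b hb).symm (hAB w' (hN w' hvw') b hb).symm hxy hyw (hvb b hb) hvx hvy
      (hx w hvw) (hx w' hvw') hyw'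
  · push Not at hyN
    exact hasForbiddenMinor_of_doubled_pairs hvn hvn' (hAB x hxA b hb) hxy
      (hAB n (hN n hvn) b hb) (hyN n hvn).symm (hAB n' (hN n' hvn') b hb) (hyN n' hvn').symm
      hvx (hvb b hb) hvy (hx n hvn) (hx n' hvn') hnn'.symm hyb.symm

/-- If `v` has neighbours on both sides of the join, each side contains a nonadjacent pair consisting
of a neighbour and a non-neighbour of `v`, and these pairs form the complement of `P5` with `v`. -/
theorem hasForbiddenMinor_of_join {V : Type u} [Finite V] {G : SimpleGraph V}
    (hG : IsUnsplit G univ) {v : V} (hv : ¬ IsLinked (fun x y => ¬ G.Adj x y) {v}ᶜ) :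
    HasForbiddenMinor G := by
  simp only [IsLinked, not_forall, not_exists, not_and, not_not] at hv
  obtain ⟨A, hA, hA₀, hB₀, hAB⟩ := hv
  set B := {v}ᶜ \ A with hB
  have hcov : ∀ z, z = v ∨ z ∈ A ∨ z ∈ B := by
    intro z
    simp only [hB, mem_sdiff, mem_compl_iff, mem_singleton_iff]
    tauto
  have hvA : v ∉ A := fun h => hA h rfl
  have hvB : v ∉ B := fun h => h.1 rfl
  have hBA : ∀ x ∈ B, ∀ y ∈ A, G.Adj x y := fun x hx y hy => (hAB y hy x hx).symm
  by_cases hNA : ∀ z, G.Adj v z → z ∈ A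
  · exact hasForbiddenMinor_of_join_left hG hcov hB₀ hvB hAB hNA
  by_cases hNB : ∀ z, G.Adj v z → z ∈ B
  · exact hasForbiddenMinor_of_join_left hG (fun z => (hcov z).imp_right Or.symm) hA₀ hvA hBA hNB
  have mixed : ∀ A B : Set V, (∀ z, z = v ∨ z ∈ A ∨ z ∈ B) → (∀ x ∈ A, ∀ y ∈ B, G.Adj x y) →
      (¬ ∀ z, G.Adj v z → z ∈ B) → ∃ x ∈ A, ∃ y ∈ A, G.Adj v x ∧ ¬ G.Adj v y ∧ ¬ G.Adj x y := by
    intro A B hcov hAB h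
    push Not at h
    obtain ⟨z, hvz, hz⟩ := h
    have hzA : z ∈ A := ((hcov z).resolve_left hvz.ne').resolve_right hz
    obtain ⟨x, y, ⟨hxA, hvx⟩, hy, hxy⟩ := hG.exists_coAdj (fun z => z ∈ A ∧ G.Adj v z)
      ⟨z, hzA, hvz⟩ ⟨v, fun h => G.irrefl h.2⟩
    have hyA : y ∈ A := by
      rcases hcov y with rfl | h | h
      exacts [(hxy hvx.symm).elim, h, (hxy (hAB x hxA y h)).elim]
    exact ⟨x, hxA, y, hyA, hvx, fun h => hy ⟨hyA, h⟩, hxy⟩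
  obtain ⟨x, hx, y, hy, hvx, hvy, hxy⟩ := mixed A B hcov hAB hNB
  obtain ⟨x', hx', y', hy', hvx', hvy', hxy'⟩ :=
    mixed B A (fun z => (hcov z).imp_right Or.symm) hBA hNA
  exact hasForbiddenMinor_of_coPath (a := x) (b := y) (c := v) (d := y') (e := x') hxy
    (fun h => hvy h.symm) hvy' (fun h => hxy' h.symm) hvx.symm (hAB x hx y' hy')
    (hAB x hx x' hx') (hAB y hy y' hy') (hAB y hy x' hx') hvx'

/-! ### Smallest fragments of two-vertex cuts -/

/-- `X` is a nonempty set of vertices that `s` and `t` separate from a nonempty rest of the graph;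
`s = t` is allowed. -/
structure IsFragment {V : Type u} (G : SimpleGraph V) (X : Set V) (s t : V) : Prop where
  nonempty : X.Nonempty
  left_notMem : s ∉ X
  right_notMem : t ∉ X
  exists_outside : ∃ z, z ∉ X ∧ z ≠ s ∧ z ≠ t
  adj : ∀ x ∈ X, ∀ y, G.Adj x y → y ∈ X ∨ y = s ∨ y = t

/-- No single vertex `t` separates a nonempty `X` from a nonempty rest. -/
theorem IsUnsplit.eq_empty_of_adj {V : Type u} {G : SimpleGraph V} (hG : IsUnsplit G univ)
    {X : Set V} {t : V} (ht : t ∉ X) (hz : ∃ z, z ∉ X ∧ z ≠ t)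
    (hX : ∀ x ∈ X, ∀ y, G.Adj x y → y ∈ X ∨ y = t) : X = ∅ := by
  by_contra h
  obtain ⟨x₀, hx₀⟩ := nonempty_iff_ne_empty.2 h
  obtain ⟨x, y, -, hyt, hx, hy, hxy⟩ := hG.exists_adj t (· ∈ X) ⟨x₀, fun h => ht (h ▸ hx₀), hx₀⟩
    (hz.imp fun z h => ⟨h.2, h.1⟩)
  exact (hX x hx y hxy).elim hy hyt

/-- A smallest fragment `X` has one vertex when every vertex lies in a 2-cut. Otherwise cut at
`u ∈ X` and some `w`: uncrossing the two cuts, each corner of the two separations has at most two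
attachments, so it is empty by the absence of cut vertices or by minimality. -/
theorem IsFragment.subsingleton_of_minimal {V : Type u} [Finite V] {G : SimpleGraph V}
    (hG : IsUnsplit G univ) {X : Set V} {s t : V} (hX : IsFragment G X s t)
    (hmin : ∀ Y p q, IsFragment G Y p q → X.ncard ≤ Y.ncard)
    (hcut : ∀ v, ∃ w P Q, IsFragment G P v w ∧ IsFragment G Q v w ∧ Disjoint P Q ∧
      ∀ z, z = v ∨ z = w ∨ z ∈ P ∨ z ∈ Q) : X.Subsingleton := by
  intro u hu
  by_contra! hne
  obtain ⟨u', hu', huu'⟩ := hne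
  obtain ⟨w, P, Q, hP, hQ, hPQ, hcov⟩ := hcut u
  let D : Set V := {z | z ∉ X ∧ z ≠ s ∧ z ≠ t}
  have hD : D.Nonempty := hX.exists_outside
  have hDadj : ∀ x ∈ D, ∀ y, G.Adj x y → y ∈ D ∨ y = s ∨ y = t := by
    intro x hx y hxy
    by_contra! h
    refine (hX.adj y ?_ x hxy.symm).elim hx.1 fun h => h.elim hx.2.1 hx.2.2
    by_contra hy
    exact h.1 ⟨hy, h.2⟩
  have hus : u ≠ s := fun h => hX.left_notMem (h ▸ hu)
  have hut : u ≠ t := fun h => hX.right_notMem (h ▸ hu)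
  -- `small` uses minimality of `X`, `smallD` the absence of cut vertices.
  have small : ∀ Y ⊆ X, u ∉ Y → ∀ q, q ∉ Y → q ∉ D →
      (∀ x ∈ Y, ∀ y, G.Adj x y → y ∈ Y ∨ y = u ∨ y = q) → Y = ∅ := by
    intro Y hYX huY q hqY hqD hY
    by_contra h
    obtain ⟨d, hd⟩ := hD
    refine (hmin Y u q ⟨nonempty_iff_ne_empty.2 h, huY, hqY, ⟨d, fun h => hd.1 (hYX h),
      fun h => hd.1 (h ▸ hu), fun h => hqD (h ▸ hd)⟩, hY⟩).not_gt (ncard_lt_ncard ?_ (toFinite _))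
    exact ⟨hYX, fun h => huY (h hu)⟩
  have smallD : ∀ Y ⊆ D, ∀ q, q ∉ Y → q ≠ u →
      (∀ x ∈ Y, ∀ y, G.Adj x y → y ∈ Y ∨ y = q) → Y = ∅ := fun Y hYD q hqY hqu hY =>
    hG.eq_empty_of_adj hqY ⟨u, fun h => (hYD h).1 hu, hqu.symm⟩ hY
  have hwu : w ≠ u := by
    rintro rfl
    exact hP.nonempty.ne_empty (hG.eq_empty_of_adj hP.left_notMem
      (hP.exists_outside.imp fun z h => ⟨h.1, h.2.1⟩) fun x hx y hxy => by
        simpa using hP.adj x hx y hxy)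
  -- A side of the second cut without `s` and `t` has both its corners empty.
  have meets : ∀ P, IsFragment G P u w → s ∈ P ∨ t ∈ P := by
    intro P hP
    by_contra! h
    have h₁ : X ∩ P = ∅ := by
      by_cases hwD : w ∈ D
      · refine small _ inter_subset_left (fun h => hP.left_notMem h.2) u
          (fun h => hP.left_notMem h.2) (fun h => h.1 hu) fun x hx y hxy => ?_
        have := hX.adj x hx.1 y hxy
        have := hP.adj x hx.2 y hxy
        grind
      · refine small _ inter_subset_left (fun h => hP.left_notMem h.2) w
          (fun h => hP.right_notMem h.2) hwD fun x hx y hxy => ?_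
        have := hX.adj x hx.1 y hxy
        have := hP.adj x hx.2 y hxy
        grind
    have h₂ : D ∩ P = ∅ := by
      refine smallD _ inter_subset_left w (fun h => hP.right_notMem h.2) hwu fun x hx y hxy => ?_
      have := hDadj x hx.1 y hxy
      have := hP.adj x hx.2 y hxy
      grind
    obtain ⟨z, hz⟩ := hP.nonempty
    by_cases hzX : z ∈ X
    · exact h₁.subset ⟨hzX, hz⟩
    · exact h₂.subset ⟨⟨hzX, fun e => h.1 (e ▸ hz), fun e => h.2 (e ▸ hz)⟩, hz⟩
  -- If `s` and `t` lie on different sides, either `D` or `X` has both its corners empty.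
  have separated : ∀ P Q, IsFragment G P u w → IsFragment G Q u w → Disjoint P Q →
      (∀ z, z = u ∨ z = w ∨ z ∈ P ∨ z ∈ Q) → s ∈ P → t ∈ Q → False := by
    intro P Q hP hQ hPQ hcov hs ht
    have hsw : s ≠ w := fun h => hP.right_notMem (h ▸ hs)
    have htw : t ≠ w := fun h => hQ.right_notMem (h ▸ ht)
    have hsQ : s ∉ Q := fun h => hPQ.ne_of_mem hs h rfl
    have htP : t ∉ P := fun h => hPQ.ne_of_mem h ht rfl
    by_cases hwX : w ∈ X
    · have h₁ : D ∩ P = ∅ := by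
        refine smallD _ inter_subset_left s (fun h => h.1.2.1 rfl) hus.symm fun x hx y hxy => ?_
        have := hDadj x hx.1 y hxy
        have := hP.adj x hx.2 y hxy
        have : w ∉ D := fun h => h.1 hwX
        have : u ∉ D := fun h => h.1 hu
        grind
      have h₂ : D ∩ Q = ∅ := by
        refine smallD _ inter_subset_left t (fun h => h.1.2.2 rfl) hut.symm fun x hx y hxy => ?_
        have := hDadj x hx.1 y hxy
        have := hQ.adj x hx.2 y hxy
        have : w ∉ D := fun h => h.1 hwX
        have : u ∉ D := fun h => h.1 hu
        grind
      obtain ⟨d, hd⟩ := hD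
      rcases hcov d with rfl | rfl | h | h
      exacts [hd.1 hu, hd.1 hwX, h₁.subset ⟨hd, h⟩, h₂.subset ⟨hd, h⟩]
    · have h₁ : X ∩ P = ∅ := by
        refine small _ inter_subset_left (fun h => hP.left_notMem h.2) s
          (fun h => hX.left_notMem h.1) (fun h => h.2.1 rfl) fun x hx y hxy => ?_
        have := hX.adj x hx.1 y hxy
        have := hP.adj x hx.2 y hxy
        grind
      have h₂ : X ∩ Q = ∅ := by
        refine small _ inter_subset_left (fun h => hQ.left_notMem h.2) t
          (fun h => hX.right_notMem h.1) (fun h => h.2.2 rfl) fun x hx y hxy => ?_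
        have := hX.adj x hx.1 y hxy
        have := hQ.adj x hx.2 y hxy
        grind
      rcases hcov u' with rfl | rfl | h | h
      exacts [huu' rfl, hwX hu', h₁.subset ⟨hu', h⟩, h₂.subset ⟨hu', h⟩]
  have hdisj : ∀ z ∈ P, z ∉ Q := fun z hz hz' => hPQ.ne_of_mem hz hz' rfl
  rcases meets P hP with hs | ht <;> rcases meets Q hQ with hs' | ht'
  · exact hdisj s hs hs'
  · exact separated P Q hP hQ hPQ hcov hs ht'
  · exact separated Q P hQ hP hPQ.symm (fun z => (hcov z).imp_right (Or.imp_right Or.symm)) hs' ht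
  · exact hdisj t ht ht'

theorem IsUnsplit.exists_fragments {V : Type u} {G : SimpleGraph V} (hG : IsUnsplit G univ) {v : V}
    (hv : ¬ IsUnsplit G {v}ᶜ) (hco : IsLinked (fun x y => ¬ G.Adj x y) {v}ᶜ) :
    ∃ w P Q, IsFragment G P v w ∧ IsFragment G Q v w ∧ Disjoint P Q ∧
      ∀ z, z = v ∨ z = w ∨ z ∈ P ∨ z ∈ Q := by
  have hnt : ({v}ᶜ : Set V).Nontrivial := by
    obtain ⟨y, -, hyv⟩ := hG.nontrivial.exists_ne v
    by_contra h
    rw [not_nontrivial_iff] at h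
    have : ∀ z, z = v ∨ z = y := fun z =>
      or_iff_not_imp_left.2 fun hz => h hz hyv
    have hz : ∀ p q : V, p ≠ q → G.Adj p q ∧ ¬ G.Adj p q := by
      intro p q hpq
      have hall : ∀ z, z = p ∨ z = q := by
        intro z
        rcases this p with rfl | rfl <;> rcases this q with rfl | rfl <;>
          rcases this z with rfl | rfl <;> simp_all
      constructor
      · obtain ⟨_, rfl, b, hb, hab⟩ := hG.linked ∅ subsingleton_empty {p} (by simp)
          (singleton_nonempty _) ⟨q, by simpa using hpq.symm⟩
        exact (hall b).resolve_left hb.2 ▸ hab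
      · obtain ⟨_, b, rfl, hb, hab⟩ := hG.exists_coAdj (· = p) ⟨p, rfl⟩ ⟨q, hpq.symm⟩
        exact (hall b).resolve_left hb ▸ hab
    exact (hz y v hyv).2 (hz y v hyv).1
  have hl := fun h => hv ⟨hnt, hco, h⟩
  simp only [imp_false, IsLinked, not_forall, not_exists, not_and] at hl
  obtain ⟨T, hT, X, hX, hX₀, hY₀, hXY⟩ := hl
  have hmem : ∀ z, z = v ∨ z ∈ T ∨ z ∈ X ∨ z ∈ ({v}ᶜ \ T) \ X := by
    intro z
    simp only [mem_sdiff, mem_compl_iff, mem_singleton_iff]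
    tauto
  obtain ⟨w, hw⟩ : T.Nonempty := by
    by_contra hT₀
    rw [not_nonempty_iff_eq_empty] at hT₀
    subst hT₀
    refine hX₀.ne_empty (hG.eq_empty_of_adj (fun h => (hX h).1 rfl)
      (hY₀.imp fun z hz => ⟨hz.2, hz.1.1⟩) fun x hx y hxy => ?_)
    rcases hmem y with h | h | h | h
    exacts [.inr h, h.elim, .inl h, (hXY x hx y h hxy).elim]
  obtain rfl : T = {w} := hT.eq_singleton_of_mem hw
  obtain ⟨x₀, hx₀⟩ := hX₀
  obtain ⟨y₀, hy₀⟩ := hY₀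
  refine ⟨w, X, ({v}ᶜ \ {w}) \ X, ⟨⟨x₀, hx₀⟩, fun h => (hX h).1 rfl, fun h => (hX h).2 rfl,
    ⟨y₀, hy₀.2, hy₀.1.1, hy₀.1.2⟩, fun x hx y hxy => ?_⟩, ⟨⟨y₀, hy₀⟩, fun h => h.1.1 rfl,
    fun h => h.1.2 rfl, ⟨x₀, fun h => h.2 hx₀, (hX hx₀).1, (hX hx₀).2⟩, fun x hx y hxy => ?_⟩,
    disjoint_sdiff_right, hmem⟩
  · rcases hmem y with h | h | h | h
    exacts [.inr (.inl h), .inr (.inr h), .inl h, (hXY x hx y h hxy).elim]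
  · rcases hmem y with h | h | h | h
    exacts [.inr (.inl h), .inr (.inr h), (hXY y h x hx hxy.symm).elim, .inl h]

theorem IsUnsplit.exists_fragment_singleton {V : Type u} [Finite V] {G : SimpleGraph V}
    (hG : IsUnsplit G univ) (hv : ∀ v, ¬ IsUnsplit G {v}ᶜ)
    (hco : ∀ v, IsLinked (fun x y => ¬ G.Adj x y) {v}ᶜ) : ∃ v s t, IsFragment G {v} s t := by
  have hcut := fun v => hG.exists_fragments (hv v) (hco v)
  obtain ⟨v₀, -⟩ := hG.nontrivial.nonempty
  obtain ⟨w, P, Q, hP, -⟩ := hcut v₀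
  obtain ⟨⟨X, s, t⟩, hX, hmin⟩ := Set.exists_min_image
    {F : Set V × V × V | IsFragment G F.1 F.2.1 F.2.2} (fun F => F.1.ncard) (toFinite _) ⟨⟨P, v₀, w⟩, hP⟩
  obtain ⟨v, hvX⟩ := hX.nonempty
  have hX' : IsFragment G X s t := hX
  have := (hX'.subsingleton_of_minimal hG (fun Y p q hY => hmin ⟨Y, p, q⟩ hY)
    hcut).eq_singleton_of_mem hvX
  exact ⟨v, s, t, this ▸ hX'⟩

/-! ### A vertex of degree two -/

/-- The vertex `v` has the neighbours `x` and `y` only, and `x` is adjacent to everything but `y`. A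
non-neighbour and a neighbour of `y` that are adjacent complete `v, x, y` to the complement of `P5`. -/
theorem hasForbiddenMinor_of_coBridge_leaf {V : Type u} [Finite V] {G : SimpleGraph V}
    (hG : IsUnsplit G univ) {v x y : V} (hvx : G.Adj v x) (hvy : G.Adj v y)
    (hdeg : ∀ z, G.Adj v z → z = x ∨ z = y) (hxy : ¬ G.Adj x y) (hne : x ≠ y)
    (hx : ∀ z, z ≠ v → z ≠ x → z ≠ y → G.Adj x z) (hz : ∃ z, z ≠ v ∧ z ≠ x ∧ z ≠ y)
    (hco : IsLinked (fun x y => ¬ G.Adj x y) {v}ᶜ) : HasForbiddenMinor G := by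
  obtain ⟨z, hzv, hzx, hzy⟩ := hz
  obtain ⟨p, hp, q, hq, hpq⟩ := hco {z | z ≠ v ∧ z ≠ x ∧ z ≠ y} (fun z hz => hz.1)
    ⟨z, hzv, hzx, hzy⟩ ⟨y, hvy.ne', fun h => h.2.2 rfl⟩
  have hpy : ¬ G.Adj p y := by
    have hq' : q = x ∨ q = y := by
      by_contra! h
      exact hq.2 ⟨hq.1, h⟩
    rcases hq' with rfl | rfl
    exacts [(hpq (hx p hp.1 hp.2.1 hp.2.2).symm).elim, hpq]
  obtain ⟨b, c, -, hcx, ⟨hbv, hbx, hby, hb⟩, hc, hbc⟩ := hG.exists_adj x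
    (fun z => z ≠ v ∧ z ≠ x ∧ z ≠ y ∧ ¬ G.Adj z y) ⟨p, hp.2.1, hp.1, hp.2.1, hp.2.2, hpy⟩
    ⟨y, hne.symm, fun h => h.2.2.1 rfl⟩
  have hcv : c ≠ v := by
    rintro rfl
    exact (hdeg b hbc.symm).elim hbx hby
  have hcy : c ≠ y := by
    rintro rfl
    exact hb hbc
  have hcy' : G.Adj c y := by
    by_contra h
    exact hc ⟨hcv, hcx, hcy, h⟩
  exact hasForbiddenMinor_of_coPath (a := c) (b := v) (c := b) (d := y) (e := x)
    (fun h => (hdeg c h.symm).elim hcx hcy) (fun h => (hdeg b h).elim hbx hby) hb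
    (fun h => hxy h.symm) hbc.symm hcy' (hx c hcv hcx hcy).symm hvy hvx (hx b hbv hbx hby).symm

/-- The neighbours `x, y` of `v` are the only nonadjacent pair between the two sides `A` and `B` of
`G - v`. With further vertices on both sides there is an induced `C5` through `v`; otherwise `x` or
`y` is adjacent to all further vertices. -/
theorem hasForbiddenMinor_of_coBridge {V : Type u} [Finite V] {G : SimpleGraph V}
    (hG : IsUnsplit G univ) {v x y : V} (hvx : G.Adj v x) (hvy : G.Adj v y)
    (hdeg : ∀ z, G.Adj v z → z = x ∨ z = y) (hxy : ¬ G.Adj x y) (hne : x ≠ y)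
    (hz : ∃ z, z ≠ v ∧ z ≠ x ∧ z ≠ y) (hco : IsLinked (fun x y => ¬ G.Adj x y) {v}ᶜ)
    {A B : Set V} (hcov : ∀ z, z ≠ v → z ∈ A ∨ z ∈ B) (hvA : v ∉ A) (hvB : v ∉ B)
    (hdis : Disjoint A B) (hxA : x ∈ A) (hyB : y ∈ B)
    (hAB : ∀ a ∈ A, ∀ b ∈ B, G.Adj a b ∨ a = x ∧ b = y) : HasForbiddenMinor G := by
  have hAv : ∀ a ∈ A, a ≠ v := fun a ha h => hvA (h ▸ ha)
  have hBv : ∀ b ∈ B, b ≠ v := fun b hb h => hvB (h ▸ hb)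
  by_cases hA : ∃ a ∈ A, a ≠ x
  swap
  · push Not at hA
    refine hasForbiddenMinor_of_coBridge_leaf hG hvx hvy hdeg hxy hne (fun z hzv hzx hzy => ?_)
      hz hco
    exact (hAB x hxA z ((hcov z hzv).resolve_left fun h => hzx (hA z h))).resolve_right
      fun h => hzy h.2
  by_cases hB : ∃ b ∈ B, b ≠ y
  swap
  · push Not at hB
    refine hasForbiddenMinor_of_coBridge_leaf hG hvy hvx (fun z h => (hdeg z h).symm)
      (fun h => hxy h.symm) hne.symm (fun z hzv hzy hzx => ?_)
      (hz.imp fun z h => ⟨h.1, h.2.2, h.2.1⟩) hco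
    exact ((hAB z ((hcov z hzv).resolve_right fun h => hzy (hB z h)) y hyB).resolve_right
      fun h => hzx h.1).symm
  obtain ⟨a₀, ha₀, ha₀x⟩ := hA
  obtain ⟨b₀, hb₀, hb₀y⟩ := hB
  obtain ⟨a, ⟨haA, hax⟩, q, hq, haq⟩ := hco (A \ {x}) (fun a ha => hAv a ha.1) ⟨a₀, ha₀, ha₀x⟩
    ⟨x, hvx.ne', fun h => h.2 rfl⟩
  have hqx : q = x := by
    rcases hcov q hq.1 with h | h
    · by_contra hqx
      exact hq.2 ⟨h, hqx⟩
    · exact ((hAB a haA q h).elim haq fun h => hax h.1).elim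
  obtain ⟨b, ⟨hbB, hby⟩, r, hr, hbr⟩ := hco (B \ {y}) (fun b hb => hBv b hb.1) ⟨b₀, hb₀, hb₀y⟩
    ⟨y, hvy.ne', fun h => h.2 rfl⟩
  have hry : r = y := by
    rcases hcov r hr.1 with h | h
    · exact ((hAB r h b hbB).elim (fun h => hbr h.symm) fun h => hby h.2).elim
    · by_contra hry
      exact hr.2 ⟨h, hry⟩
  subst hqx hry
  have hav : ¬ G.Adj v a := fun h => (hdeg a h).elim hax fun h => hdis.ne_of_mem haA hyB h
  have hbv : ¬ G.Adj v b := fun h => (hdeg b h).elim (fun h => hdis.ne_of_mem hxA hbB h.symm) hby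
  exact hasForbiddenMinor_of_cycle (a := v) (b := q) (c := b) (d := a) (e := r) hvx
    ((hAB q hxA b hbB).resolve_right fun h => hby h.2)
    ((hAB a haA b hbB).resolve_right fun h => hax h.1).symm
    ((hAB a haA r hyB).resolve_right fun h => hax h.1) hvy hbv hav (fun h => haq h.symm) hxy hbr

/-- Contracting an edge at a vertex of degree two creates no cut vertex, so by `hc` the contracted
graph is a join. -/
theorem hasForbiddenMinor_of_degree_two {V : Type u} [Finite V] {G : SimpleGraph V}
    (hG : IsUnsplit G univ) {v x y : V} (hvx : G.Adj v x) (hvy : G.Adj v y)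
    (hdeg : ∀ z, G.Adj v z → z = x ∨ z = y) (hne : x ≠ y)
    (hz : ∃ z, z ≠ v ∧ z ≠ x ∧ z ≠ y) (hco : IsLinked (fun x y => ¬ G.Adj x y) {v}ᶜ)
    (hc : ¬ IsUnsplit (contractEdge G x v) univ) : HasForbiddenMinor G := by
  have hadj : ∀ p q : {z : V // z ≠ v}, (contractEdge G x v).Adj p q ↔
      G.Adj p q ∨ (p : V) = x ∧ (q : V) = y ∨ (p : V) = y ∧ (q : V) = x := by
    intro p q
    rw [contractEdge_adj]
    constructor
    · rintro ⟨hpq, h | ⟨hp, hq⟩ | ⟨hq, hp⟩⟩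
      · exact .inl h
      · exact .inr (.inl ⟨hp, (hdeg q hq).resolve_left fun h => hpq (hp.trans h.symm)⟩)
      · exact .inr (.inr ⟨(hdeg p hp).resolve_left fun h => hpq (h.trans hq.symm), hq⟩)
    · rintro (h | ⟨hp, hq⟩ | ⟨hp, hq⟩)
      · exact ⟨h.ne, .inl h⟩
      · exact ⟨by rwa [hp, hq], .inr (.inl ⟨hp, hq ▸ hvy⟩)⟩
      · exact ⟨by rw [hp, hq]; exact hne.symm, .inr (.inr ⟨hq, hp ▸ hvy⟩)⟩
  have hval : ∀ (Y : Set {z : V // z ≠ v}) (p : {z : V // z ≠ v}),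
      (p : V) ∈ Subtype.val '' Y ↔ p ∈ Y := fun _ _ =>
    Subtype.val_injective.mem_set_image
  have hlinked : ∀ T : Set {z : V // z ≠ v}, T.Subsingleton →
      IsLinked (contractEdge G x v).Adj (univ \ T) := by
    intro T hT X hX hX₀ hY₀
    -- Put `v` on the side of a neighbour in `X`, if there is one.
    obtain ⟨p, hp, q, hq, hpq⟩ := hG.linked (Subtype.val '' T) (hT.image _)
      (Subtype.val '' X ∪ {z | z = v ∧ ∃ p ∈ X, G.Adj v p})
      (by
        rintro _ (⟨p, hp, rfl⟩ | ⟨rfl, -⟩)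
        · exact ⟨trivial, (hval T p).not.2 (hX hp).2⟩
        · simp)
      ((hX₀.image _).mono subset_union_left)
      (by
        obtain ⟨q, hq⟩ := hY₀
        exact ⟨q, ⟨trivial, (hval T q).not.2 hq.1.2⟩,
          fun h => h.elim ((hval X q).not.2 hq.2) fun h => q.2 h.1⟩)
    have hq' : ∀ h : q ≠ v, ⟨q, h⟩ ∈ (univ \ T) \ X := fun h =>
      ⟨⟨trivial, fun hT => hq.1.2 ⟨_, hT, rfl⟩⟩, fun hX => hq.2 (.inl ⟨_, hX, rfl⟩)⟩
    rcases hp with ⟨p, hp, rfl⟩ | ⟨rfl, r, hr, hvr⟩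
    · have hqv : q ≠ v := by
        rintro rfl
        exact hq.2 (.inr ⟨rfl, p, hp, hpq.symm⟩)
      exact ⟨p, hp, ⟨q, hqv⟩, hq' hqv, (hadj _ _).2 (.inl hpq)⟩
    · refine ⟨r, hr, ⟨q, hpq.ne'⟩, hq' hpq.ne', (hadj _ _).2 (.inr ?_)⟩
      have hrq : (r : V) ≠ q := fun h => (hq' hpq.ne').2 (by convert hr; exact h.symm)
      rcases hdeg r hvr with h₁ | h₁ <;> rcases hdeg q hpq with h₂ | h₂
      · exact (hrq (h₁.trans h₂.symm)).elim
      · exact .inl ⟨h₁, h₂⟩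
      · exact .inr ⟨h₁, h₂⟩
      · exact (hrq (h₁.trans h₂.symm)).elim
  have hcol : ¬ IsLinked (fun p q => ¬ (contractEdge G x v).Adj p q) univ := fun h =>
    hc ⟨⟨⟨x, hvx.ne'⟩, trivial, ⟨y, hvy.ne'⟩, trivial, fun h => hne (congrArg Subtype.val h)⟩, h,
      hlinked⟩
  simp only [IsLinked, not_forall, not_exists, not_and, not_not] at hcol
  obtain ⟨X, -, hX₀, hY₀, hXY⟩ := hcol
  have hcov : ∀ z, z ≠ v → z ∈ Subtype.val '' X ∨ z ∈ Subtype.val '' (univ \ X) := by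
    intro z hz
    by_cases h : ⟨z, hz⟩ ∈ X
    exacts [.inl ⟨_, h, rfl⟩, .inr ⟨_, ⟨trivial, h⟩, rfl⟩]
  have hvimage : ∀ X : Set {z : V // z ≠ v}, v ∉ Subtype.val '' X := by
    rintro X ⟨p, -, hp⟩
    exact p.2 hp
  have hdis : Disjoint (Subtype.val '' X) (Subtype.val '' (univ \ X)) :=
    (disjoint_image_iff Subtype.val_injective).2 disjoint_sdiff_right
  -- As `G - v` is not a join, the edge `xy` created by the contraction crosses the join.
  obtain ⟨_, ⟨p, hp, rfl⟩, q, hq, hpq⟩ := hco (Subtype.val '' X)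
    (by rintro _ ⟨p, -, rfl⟩; exact p.2) (hX₀.image _)
    (hY₀.imp' Subtype.val fun q hq => ⟨q.2, (hval X q).not.2 hq.2⟩)
  have hqX : (⟨q, hq.1⟩ : {z : V // z ≠ v}) ∈ univ \ X := ⟨trivial, fun h => hq.2 ⟨_, h, rfl⟩⟩
  have hxyX := ((hadj _ _).1 (hXY p hp _ hqX)).resolve_left hpq
  have hjoin : ∀ a ∈ Subtype.val '' X, ∀ b ∈ Subtype.val '' (univ \ X),
      G.Adj a b ∨ a = x ∧ b = y ∨ a = y ∧ b = x := by
    rintro _ ⟨a, ha, rfl⟩ _ ⟨b, hb, rfl⟩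
    exact (hadj a b).1 (hXY a ha b hb)
  have hpA : (p : V) ∈ Subtype.val '' X := ⟨p, hp, rfl⟩
  have hqB : q ∈ Subtype.val '' (univ \ X) := ⟨_, hqX, rfl⟩
  rcases hxyX with ⟨hpx, hqy⟩ | ⟨hpy, hqx⟩
  · dsimp only at hqy
    rw [hpx] at hpA hpq
    rw [hqy] at hqB hpq
    exact hasForbiddenMinor_of_coBridge hG hvx hvy hdeg hpq hne hz hco hcov (hvimage _) (hvimage _)
      hdis hpA hqB fun a ha b hb => (hjoin a ha b hb).imp_right
        fun h => h.resolve_right fun h => hdis.ne_of_mem ha hqB h.1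
  · dsimp only at hqx
    rw [hpy] at hpA hpq
    rw [hqx] at hqB hpq
    exact hasForbiddenMinor_of_coBridge hG hvy hvx (fun z h => (hdeg z h).symm) hpq hne.symm
      (hz.imp fun z h => ⟨h.1, h.2.2, h.2.1⟩) hco hcov (hvimage _) (hvimage _)
      hdis hpA hqB fun a ha b hb => (hjoin a ha b hb).imp_right
        fun h => h.resolve_left fun h => hdis.ne_of_mem ha hqB h.1

/-! ### Unsplit graphs have forbidden minors -/

theorem HasForbiddenMinor.of_deleteVertex {V : Type u} {G : SimpleGraph V} {v : V}
    (h : HasForbiddenMinor (deleteVertex G v)) : HasForbiddenMinor G := by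
  unfold HasForbiddenMinor at h ⊢
  exact h.imp (.delete v) <| .imp (.delete v) <| .imp (.delete v) <| .imp (.delete v) <|
    .imp (.delete v) <| .imp (.delete v) (.delete v)

theorem HasForbiddenMinor.of_contractEdge {V : Type u} {G : SimpleGraph V} {u v : V}
    (huv : G.Adj u v) (h : HasForbiddenMinor (contractEdge G u v)) : HasForbiddenMinor G := by
  unfold HasForbiddenMinor at h ⊢
  exact h.imp (.contract u v huv) <| .imp (.contract u v huv) <| .imp (.contract u v huv) <|
    .imp (.contract u v huv) <| .imp (.contract u v huv) <|
    .imp (.contract u v huv) (.contract u v huv)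

theorem hasForbiddenMinor_of_isUnsplit {V : Type u} [Finite V] {G : SimpleGraph V}
    (hG : ∃ S, IsUnsplit G S) : HasForbiddenMinor G := by
  induction hn : Nat.card V using Nat.strong_induction_on generalizing V with
  | _ n ih =>
  have hcard : ∀ v : V, Nat.card {z : V // z ≠ v} < n := fun v =>
    hn ▸ Finite.card_subtype_lt (x := v) (by simp)
  obtain ⟨S, hS⟩ := hG
  have proper : ∀ v, ∀ S : Set V, v ∉ S → IsUnsplit G S → HasForbiddenMinor G := by
    intro v S hv hS
    refine .of_deleteVertex (v := v) (ih _ (hcard v) ⟨Subtype.val ⁻¹' S, ?_⟩ rfl)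
    refine (isUnsplit_image_iff (H := G) (f := Subtype.val) Subtype.val_injective.injOn
      fun _ _ _ _ => Iff.rfl).1 ?_
    rwa [image_preimage_eq_of_subset]
    exact fun z hz => ⟨⟨z, fun h => hv (h ▸ hz)⟩, rfl⟩
  by_cases hSu : S = univ
  swap
  · obtain ⟨v, hv⟩ := (ne_univ_iff_exists_notMem S).1 hSu
    exact proper v S hv hS
  subst hSu
  by_cases hco : ∀ v, IsLinked (fun x y => ¬ G.Adj x y) {v}ᶜ
  swap
  · push Not at hco
    exact hasForbiddenMinor_of_join hS hco.choose_spec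
  by_cases hdel : ∃ v, IsUnsplit G {v}ᶜ
  · obtain ⟨v, hv⟩ := hdel
    exact proper v _ (by simp) hv
  push Not at hdel
  obtain ⟨v, x, y, hF⟩ := hS.exists_fragment_singleton hdel hco
  have hdeg : ∀ z, G.Adj v z → z = x ∨ z = y := fun z hz =>
    (hF.adj v rfl z hz).resolve_left fun h => hz.ne' h
  obtain ⟨z, hzv, hzx, hzy⟩ := hF.exists_outside
  obtain ⟨x', hx', hvx⟩ := hS.exists_adj_ne v y ⟨z, hzv, hzy⟩ fun h => hF.right_notMem h.symm
  obtain rfl := (hdeg x' hvx).resolve_right hx'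
  obtain ⟨y', hy', hvy⟩ := hS.exists_adj_ne v x' ⟨z, hzv, hzx⟩ hvx.ne
  obtain rfl := (hdeg y' hvy).resolve_left hy'
  by_cases hc : IsUnsplit (contractEdge G x' v) univ
  · exact .of_contractEdge hvx.symm (ih _ (hcard v) ⟨_, hc⟩ rfl)
  · exact hasForbiddenMinor_of_degree_two hS hvx hvy hdeg hx' ⟨z, hzv, hzx, hzy⟩ (hco v) hc

end Sesqui

theorem corollary1p3 {V : Type*} [Finite V] [Nonempty V] (G : SimpleGraph V) :
    Sesqui.IsSesquicograph G ↔
      ¬ (Sesqui.HasInducedMinor G Sesqui.C5 ∨ Sesqui.HasInducedMinor G Sesqui.P5c ∨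
        Sesqui.HasInducedMinor G Sesqui.H1 ∨ Sesqui.HasInducedMinor G Sesqui.H2 ∨
        Sesqui.HasInducedMinor G Sesqui.H3 ∨ Sesqui.HasInducedMinor G Sesqui.H4 ∨
        Sesqui.HasInducedMinor G Sesqui.H5) := by
  rw [Sesqui.isSesquicograph_iff, not_iff_not]
  refine ⟨Sesqui.hasForbiddenMinor_of_isUnsplit, ?_⟩
  rintro (h | h | h | h | h | h | h)
  exacts [h.exists_isUnsplit Sesqui.exists_isUnsplit_C5,
    h.exists_isUnsplit Sesqui.exists_isUnsplit_P5c, h.exists_isUnsplit Sesqui.exists_isUnsplit_H1,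
    h.exists_isUnsplit Sesqui.exists_isUnsplit_H2, h.exists_isUnsplit Sesqui.exists_isUnsplit_H3,
    h.exists_isUnsplit Sesqui.exists_isUnsplit_H4, h.exists_isUnsplit Sesqui.exists_isUnsplit_H5]
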